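/- Let $\tau>0$, $\delta\in(0,1)$, $\rho=\frac{1-\delta}{1+\delta}$, and let $f,g:\mathbb R^n\to\mathbb R^n$ be locally Lipschitz. Write $L_Xh(x)=\frac{\partial h}{\partial x}(x)X(x)$. A function is of class $\mathcal K_\infty$ if it is continuous and strictly increasing on $[0,\infty)$, zero at zero and unbounded. Assume: (A1) $V$ is a $C^1$, positive definite, proper function, $\kappa_1,\kappa_2$ are of class $\mathcal K_\infty$, $W$ is continuous and positive definite, and $z:\mathbb R^n\to\mathbb R$ is $C^1$ with $z(0)=0$, such that for all $x$ one has $\kappa_1(|x|)\le V(x)\le\kappa_2(|x|)$ and $\frac{\partial V}{\partial x}(x)\,[f(x)+g(x)(1+p)z(x)]\le -W(x)$ for all $p\in[-\delta,\delta]$. (A2) $\Omega\ge 16\tau$, and for all $x\in\mathbb R^n$, all continuous, piecewise $C^1$ functions $\xi:[0,2\tau]\to\mathbb R^n$, all $\lambda_1\in[-1,1]$ and all piecewise continuous $\lambda_2:[0,\tau]\to[1-\delta,1+\delta]$, $$-\tfrac14W(x)-L_gV(x)(1+\lambda_1\delta)\int_\tau^{2\tau}\big[L_fz(\xi(\ell))+L_gz(\xi(\ell))\,\lambda_2(\ell-\tau)\,z(\xi(\ell-\tau))\big]d\ell-\frac1\Omega\int_0^{2\tau}W(\xi(\ell))\,d\ell\le0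 .$$ (A3) $\kappa_3$ is a nondecreasing $C^1$ function on $[0,\infty)$ such that for all $x\in\mathbb R^n$, $L\ge0$ and $\lambda\in[-1,1]$, $$-\tfrac12W(x)+\sup_{|a|\le L}\{L_gV(x)(1+\lambda)[z(a)-z(x)]\}\le\kappa_3(L)[V(x)+1].$$ Quantizer. For $u_0>0$ and an integer $j\ge1$ let $u_i=\rho^iu_0$ for $0\le i\le j$, $\tilde u_{2i}=u_i$ and $\tilde u_{2i+1}=\frac{u_i}{1+\delta}$ for $0\le i\le j$, and $\tilde u_{2j+2}=0$. Given a $C^1$ feedback $z$ and a $C^1$ function $\varphi:[-2\tau,0]\to\mathbb R^n$, a hysteretic solution of $$\dot x(t)=f(x(t))+g(x(t))\,\Psi(z(x(t-\tau)))\qquad(*)$$ on $[-2\tau,T)$, $0<T\le\infty$, is a continuous function $x$ with $x=\varphi$ on $[-2\tau,0]$ and with the following properties. Put $\bar z(t)=z(x(t-\tau))$. For $t\in[0,T)$ one has $|\bar z(t)|\le\frac{u_0}{1-\delta}$, and the quantizer output is $\Psi(t)={\rm sgn}(\bar z(t))\,\tilde u_{k(t)}$. At $t=0$: $k(0)=2i$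 if $\frac{u_i}{1+\delta}<|\bar z(0)|\le\frac{u_i}{1-\delta}$ for some $0\le i\le j$, and $k(0)=2j+2$ if $|\bar z(0)|\le\frac{u_j}{1+\delta}$. The index $k$ is piecewise constant, with $k(t)$ the value just before a possible switch at $t$, and the value $k(t^+)$ just after $t$ is: $k(t)+1$ if $k(t)\le2j+1$ and $|\bar z(t)|=\frac{\tilde u_{k(t)}}{1+\delta}$; $k(t)-1$ if $1\le k(t)\le2j+1$ and $|\bar z(t)|=\frac{\tilde u_{k(t)}}{1-\delta}$; $2j+1$ if $k(t)=2j+2$ and $|\bar z(t)|=\tilde u_{2j+1}$; and $k(t)$ otherwise. Finally, for all $t\in[0,T)$ the right derivative of $x$ at $t$ is $f(x(t))+g(x(t))\,{\rm sgn}(\bar z(t))\,\tilde u_{k(t^+)}$. For $\varepsilon>0$ we say that the solution of $(*)$ with initial function $\varphi$ enters $B_\varepsilon$ if there is a hysteretic solution $x$ on $[-2\tau,\infty)$ with initial function $\varphi$, every hysteretic solution with initial function $\varphi$ on some $[-2\tau,T)$ is a restriction of it (including its index $k$), and there is $t_s\ge0$ with $|x(t)|\le\varepsilon$ for all $t\ge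 t_s$. Conclusion. The system $\dot x(t)=f(x(t))+g(x(t))v(t-\tau)$ is semi-globally practically stabilizable by quantized feedback: for all $0<\varepsilon<R$ there are a $C^1$ feedback, a real $u_0>0$ and an integer $j\ge1$ such that, for each $\varphi\in C^1([-2\tau,0],\mathbb R^n)$ with $\sup|\varphi|\le R$, the solution of $(*)$, with this feedback in place of $z$, enters $B_\varepsilon$. Explicitly, there are a positive, continuous, nondecreasing function $u_0(\cdot)$ on $[0,\infty)$ and a positive continuous function $j(\cdot,\cdot)$ on $(0,\infty)\times[0,\infty)$ such that, for all $R>\varepsilon>0$, all real $u_0\ge u_0(R)$ and all integers $$j\ \ge\ j(\varepsilon,R)+\frac{\log\big(u_0/u_0(R)\big)}{\log\frac{1+\delta}{1-\delta}}$$ (that is, $j\ge j(\varepsilon,R)$ when $u_0=u_0(R)$), with $z$ the feedback of (A1), the solution of $(*)$ enters $B_\varepsilon$ for every $\varphi\in C^1([-2\tau,0],\mathbb R^n)$ with $\sup|\varphi|\le R$. -/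

import Mathlib

open Set Filter Topology

noncomputable section

/-- Class `K∞`: continuous, zero at zero, strictly increasing and unbounded on `[0, ∞)`. -/
structure IsClassKInfty (κ : ℝ → ℝ) : Prop where
  continuousOn : ContinuousOn κ (Ici 0)
  zero : κ 0 = 0
  strictMonoOn : StrictMonoOn κ (Ici 0)
  tendsto : Tendsto κ atTop atTop

/-- Positive definite function on `ℝⁿ`. -/
def IsPosDefFun {n : ℕ} (F : EuclideanSpace ℝ (Fin n) → ℝ) : Prop :=
  F 0 = 0 ∧ ∀ x, x ≠ 0 → 0 < F x

/-- Lie derivative `L_X h (x) = (∂h/∂x)(x) X(x)`. -/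
def lieDer {n : ℕ} (X : EuclideanSpace ℝ (Fin n) → EuclideanSpace ℝ (Fin n))
    (h : EuclideanSpace ℝ (Fin n) → ℝ) (x : EuclideanSpace ℝ (Fin n)) : ℝ :=
  fderiv ℝ h x (X x)

/-- Piecewise continuous on `[a, b]`: there are finitely many break points such that on every
subinterval without a break point in its interior the function agrees, in the interior, with a
function that is continuous on the closed subinterval. -/
def PiecewiseContOn {F : Type*} [TopologicalSpace F] (h : ℝ → F) (a b : ℝ) : Prop :=
  ∃ S : Finset ℝ, ∀ c d : ℝ, a ≤ c → c < d → d ≤ b → (∀ s ∈ S, s ∉ Ioo c d) →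
    ∃ k : ℝ → F, ContinuousOn k (Icc c d) ∧ EqOn h k (Ioo c d)

/-- (Continuous and) piecewise continuously differentiable on `[a, b]`: `C¹` on every closed
subinterval that has none of finitely many break points in its interior. -/
def PiecewiseC1On {F : Type*} [NormedAddCommGroup F] [NormedSpace ℝ F]
    (h : ℝ → F) (a b : ℝ) : Prop :=
  ContinuousOn h (Icc a b) ∧
  ∃ S : Finset ℝ, ∀ c d : ℝ, a ≤ c → c < d → d ≤ b → (∀ s ∈ S, s ∉ Ioo c d) →
    ContDiffOn ℝ 1 h (Icc c d)

/-! ### The three assumptions -/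

/-- `V` is a `C¹`, positive definite, proper Lyapunov function, and the `C¹` feedback `z`
decreases it at rate `W` for every input-gain uncertainty `p ∈ [-δ, δ]`. -/
structure RobustCLF {n : ℕ} (f g : EuclideanSpace ℝ (Fin n) → EuclideanSpace ℝ (Fin n))
    (δ : ℝ) (V W z : EuclideanSpace ℝ (Fin n) → ℝ) (κ₁ κ₂ : ℝ → ℝ) : Prop where
  V_contDiff : ContDiff ℝ 1 V
  V_posDef : IsPosDefFun V
  V_proper : Tendsto V (cocompact (EuclideanSpace ℝ (Fin n))) atTop
  κ₁_classK : IsClassKInfty κ₁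
  κ₂_classK : IsClassKInfty κ₂
  W_continuous : Continuous W
  W_posDef : IsPosDefFun W
  z_contDiff : ContDiff ℝ 1 z
  z_zero : z 0 = 0
  lower : ∀ x, κ₁ ‖x‖ ≤ V x
  upper : ∀ x, V x ≤ κ₂ ‖x‖
  decrease : ∀ x, ∀ p ∈ Icc (-δ) δ, fderiv ℝ V x (f x + ((1 + p) * z x) • g x) ≤ -W x

/-- `H(a, b, c) = L_f z(a) + L_g z(a) c z(b)`. -/
def delayH {n : ℕ} (f g : EuclideanSpace ℝ (Fin n) → EuclideanSpace ℝ (Fin n))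
    (z : EuclideanSpace ℝ (Fin n) → ℝ) (a b : EuclideanSpace ℝ (Fin n)) (c : ℝ) : ℝ :=
  lieDer f z a + lieDer g z a * c * z b

/-- `T(x, ξ, l₁, l₂) = L_g V(x) (1 + l₁ δ) ∫_τ^{2τ} H(ξ(ℓ), ξ(ℓ-τ), l₂(ℓ-τ)) dℓ`. -/
def delayT {n : ℕ} (f g : EuclideanSpace ℝ (Fin n) → EuclideanSpace ℝ (Fin n))
    (τ δ : ℝ) (V z : EuclideanSpace ℝ (Fin n) → ℝ) (x : EuclideanSpace ℝ (Fin n))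
    (ξ : ℝ → EuclideanSpace ℝ (Fin n)) (l₁ : ℝ) (l₂ : ℝ → ℝ) : ℝ :=
  lieDer g V x * (1 + l₁ * δ) *
    ∫ ℓ in τ..(2 * τ), delayH f g z (ξ ℓ) (ξ (ℓ - τ)) (l₂ (ℓ - τ))

/-- First delay-robustness inequality, with constant `Ω`. -/
def DelayRobust {n : ℕ} (f g : EuclideanSpace ℝ (Fin n) → EuclideanSpace ℝ (Fin n))
    (τ δ Ω : ℝ) (V W z : EuclideanSpace ℝ (Fin n) → ℝ) : Prop :=
  ∀ (x : EuclideanSpace ℝ (Fin n)) (ξ : ℝ → EuclideanSpace ℝ (Fin n)),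
    PiecewiseC1On ξ 0 (2 * τ) →
    ∀ l₁ ∈ Icc (-1 : ℝ) 1, ∀ l₂ : ℝ → ℝ, PiecewiseContOn l₂ 0 τ →
      (∀ m ∈ Icc 0 τ, l₂ m ∈ Icc (1 - δ) (1 + δ)) →
      -(1 / 4) * W x - delayT f g τ δ V z x ξ l₁ l₂
        - (1 / Ω) * (∫ ℓ in (0 : ℝ)..(2 * τ), W (ξ ℓ)) ≤ 0

/-- Second delay-robustness inequality, with a nondecreasing `C¹` function `κ₃` on `[0, ∞)`.
The supremum over `|a| ≤ L` is bounded by stating the inequality for every such `a`. -/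
structure GrowthRobust {n : ℕ} (g : EuclideanSpace ℝ (Fin n) → EuclideanSpace ℝ (Fin n))
    (V W z : EuclideanSpace ℝ (Fin n) → ℝ) (κ₃ : ℝ → ℝ) : Prop where
  contDiffOn : ContDiffOn ℝ 1 κ₃ (Ici 0)
  monotoneOn : MonotoneOn κ₃ (Ici 0)
  bound : ∀ (x : EuclideanSpace ℝ (Fin n)) (L : ℝ), 0 ≤ L → ∀ l ∈ Icc (-1 : ℝ) 1,
    ∀ a : EuclideanSpace ℝ (Fin n), ‖a‖ ≤ L →
      -(1 / 2) * W x + lieDer g V x * (1 + l) * (z a - z x) ≤ κ₃ L * (V x + 1)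

/-! ### The quantizer with hysteresis -/

/-- Main quantization levels `u_i = ρ^i u₀`, `ρ = (1 - δ)/(1 + δ)`. -/
def mainLevel (δ u₀ : ℝ) (i : ℕ) : ℝ := ((1 - δ) / (1 + δ)) ^ i * u₀

/-- All nonnegative levels `ũ_k`: `u_{k/2}` for `k` even and `u_{(k-1)/2}/(1+δ)` for `k` odd,
`k ≤ 2j+1`, and `ũ_{2j+2} = 0`. -/
def level (δ u₀ : ℝ) (j k : ℕ) : ℝ :=
  if k ≤ 2 * j + 1 then
    (if Even k then mainLevel δ u₀ (k / 2) else mainLevel δ u₀ ((k - 1) / 2) / (1 + δ))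
  else 0

/-- Initialization of the quantizer: `k` is the index of the level `|Ψ| = ũ_k` assigned at time
`0` to the input `w`. -/
def IsInitialMode (δ u₀ : ℝ) (j : ℕ) (w : ℝ) (k : ℕ) : Prop :=
  (∃ i ≤ j, k = 2 * i ∧
    1 / (1 + δ) * mainLevel δ u₀ i < |w| ∧ |w| ≤ 1 / (1 - δ) * mainLevel δ u₀ i) ∨
  (k = 2 * j + 2 ∧ |w| ≤ 1 / (1 + δ) * mainLevel δ u₀ j)

/-- Transition law: the index after time `t` when the index at time `t` is `k` and the input at
time `t` is `w`. -/
def nextMode (δ u₀ : ℝ) (j k : ℕ) (w : ℝ) : ℕ :=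
  if k ≤ 2 * j + 1 ∧ |w| = level δ u₀ j k / (1 + δ) then k + 1
  else if 1 ≤ k ∧ k ≤ 2 * j + 1 ∧ |w| = level δ u₀ j k / (1 - δ) then k - 1
  else if k = 2 * j + 2 ∧ |w| = level δ u₀ j (k - 1) then k - 1
  else k

/-- `(x, k)` is a hysteretic solution on `[-2τ, T)` of
`ẋ(t) = f(x(t)) + g(x(t)) Ψ(z(x(t-τ)))` with initial function `φ`: the quantizer input
`z(x(t-τ))` stays in the range of the quantizer, the quantizer output is
`Ψ(t) = sgn(z(x(t-τ))) ũ_{k(t)}`, the index `k` is constant immediately to the left of each time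
(so `k(t)` is the value before a switch at `t`), its value immediately to the right of `t` is
given by the transition law, and the right derivative of the continuous function `x` is
`f(x(t)) + g(x(t)) Ψ(t⁺)`. By compactness, there are finitely many switches in each compact
subinterval of `[0, T)`, and between switches `x` is a `C¹` solution of the differential
equation with a constant input. The global solutions are those with `T = ⊤`. -/
structure IsHystereticSolution {n : ℕ}
    (f g : EuclideanSpace ℝ (Fin n) → EuclideanSpace ℝ (Fin n))
    (z : EuclideanSpace ℝ (Fin n) → ℝ) (τ δ u₀ : ℝ) (j : ℕ)
    (φ : ℝ → EuclideanSpace ℝ (Fin n)) (T : EReal)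
    (x : ℝ → EuclideanSpace ℝ (Fin n)) (k : ℝ → ℕ) : Prop where
  history : ∀ t ∈ Icc (-(2 * τ)) 0, x t = φ t
  continuousOn : ContinuousOn x {t : ℝ | -(2 * τ) ≤ t ∧ (t : EReal) < T}
  in_range : ∀ t : ℝ, 0 ≤ t → (t : EReal) < T → |z (x (t - τ))| ≤ u₀ / (1 - δ)
  initial : IsInitialMode δ u₀ j (z (x (0 - τ))) (k 0)
  left_const : ∀ t : ℝ, 0 < t → (t : EReal) < T → ∀ᶠ s in 𝓝[<] t, k s = k t
  transition : ∀ t : ℝ, 0 ≤ t → (t : EReal) < T →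
    ∀ᶠ s in 𝓝[>] t, k s = nextMode δ u₀ j (k t) (z (x (t - τ)))
  ode : ∀ t : ℝ, 0 ≤ t → (t : EReal) < T →
    HasDerivWithinAt x
      (f (x t) + (Real.sign (z (x (t - τ))) *
        level δ u₀ j (nextMode δ u₀ j (k t) (z (x (t - τ))))) • g (x t))
      (Ici t) t

/-- The solution with initial function `φ` exists for all times, every solution on a (possibly
bounded) interval `[-2τ, T)` is a restriction of it, and it enters the closed ball of radius `ε`
in finite time and stays there afterwards. -/
def SolutionEntersBall {n : ℕ}
    (f g : EuclideanSpace ℝ (Fin n) → EuclideanSpace ℝ (Fin n))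
    (z : EuclideanSpace ℝ (Fin n) → ℝ) (τ δ u₀ : ℝ) (j : ℕ)
    (φ : ℝ → EuclideanSpace ℝ (Fin n)) (ε : ℝ) : Prop :=
  ∃ (x : ℝ → EuclideanSpace ℝ (Fin n)) (k : ℝ → ℕ),
    IsHystereticSolution f g z τ δ u₀ j φ ⊤ x k ∧
    (∀ (T : EReal) (x' : ℝ → EuclideanSpace ℝ (Fin n)) (k' : ℝ → ℕ), 0 < T →
      IsHystereticSolution f g z τ δ u₀ j φ T x' k' →
      ∀ t : ℝ, (t : EReal) < T →
        (-(2 * τ) ≤ t → x' t = x t) ∧ (0 ≤ t → k' t = k t)) ∧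
    ∃ tₛ : ℝ, 0 ≤ tₛ ∧ ∀ t : ℝ, tₛ ≤ t → ‖x t‖ ≤ ε

/-- Semi-global practical stabilizability by quantized feedback of
`ẋ(t) = f(x(t)) + g(x(t)) v(t-τ)`, for the quantization density given by `δ`. -/
def SemiGloballyPracticallyStabilizable {n : ℕ}
    (f g : EuclideanSpace ℝ (Fin n) → EuclideanSpace ℝ (Fin n)) (τ δ : ℝ) : Prop :=
  ∀ ε R : ℝ, 0 < ε → ε < R →
    ∃ (z : EuclideanSpace ℝ (Fin n) → ℝ) (u₀ : ℝ) (j : ℕ), ContDiff ℝ 1 z ∧ 0 < u₀ ∧ 1 ≤ j ∧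
      ∀ φ : ℝ → EuclideanSpace ℝ (Fin n), ContDiffOn ℝ 1 φ (Icc (-(2 * τ)) 0) →
        (∀ t ∈ Icc (-(2 * τ)) 0, ‖φ t‖ ≤ R) →
        SolutionEntersBall f g z τ δ u₀ j φ ε

end

/-! Outside its dead zone the quantizer multiplies the input by a gain in `[1-δ, 1+δ]`, an
uncertainty that (A1) tolerates. In the dead zone it differs from gain `1` by at most `u_j`. The
delay is removed by writing `z(x(t-τ))` as `z(x(t))` minus the integral over `[t-τ, t]` of the
derivative of `z` along the solution. (A2) absorbs this integral, so that for `t ≥ τ` one gets `V' ≤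
-(3/4) W + (1/Ω) ∫_{t-2τ}^t W + C u_j` (`RobustCLF.decrease_along`). The functional `V + (2/Ω)
∫_{t-2τ}^t ∫_l^t W` then decreases at a fixed rate wherever it is at least `c`, provided `u_j` is
small (`RobustCLF.lyapunov_estimate`). On `[0, τ]` (A3) and Grönwall's inequality bound `V`
(`RobustCLF.bound_first_delay`).

Solutions exist because the thresholds of consecutive modes interlace strictly: after a switch the
input is inside the new band by a uniform margin, and a Lipschitz input needs a minimal time to
cross it. Switches therefore do not accumulate, and the delay allows integration step by step
(`exists_global_hystereticSolution`). This is done for data made bounded and Lipschitz by a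
retraction onto a ball whose radius depends on the size `R` of the initial function; the Lyapunov
bound shows that the solution never reaches the sphere, so the truncation is invisible
(`RobustCLF.exists_quantizer`). Uniqueness holds because equal pasts produce equal controls on the
next delay interval (`IsHystereticSolution.eq_of_lt`).

The saturation level depends on `R` only and the resolution on `ε` and `R`. Continuous bounds are
obtained by majorizing their values at integer samples. -/

noncomputable section

/-! ### The hysteretic quantizer: thresholds, modes, gain. -/

/-- Lower switching threshold of mode `m` (negative, hence never met, in the dead zone). -/
def lowerThreshold (δ u₀ : ℝ) (j m : ℕ) : ℝ :=
  if m ≤ 2 * j + 1 then level δ u₀ j m / (1 + δ) else -1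

/-- Upper switching threshold of mode `m` (out of range for the outermost mode). -/
def upperThreshold (δ u₀ : ℝ) (j m : ℕ) : ℝ :=
  if m = 0 then u₀ / (1 - δ) + 1
  else if m ≤ 2 * j + 1 then level δ u₀ j m / (1 - δ) else level δ u₀ j (2 * j + 1)

/-- The input `w` is between the switching thresholds of mode `m`. -/
structure InMode (δ u₀ : ℝ) (j m : ℕ) (w : ℝ) : Prop where
  range : |w| ≤ u₀ / (1 - δ)
  le : m ≤ 2 * j + 2
  lower : lowerThreshold δ u₀ j m ≤ |w|
  upper : |w| ≤ upperThreshold δ u₀ j m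

section Quantizer

variable {δ u₀ : ℝ} {j : ℕ}

lemma mainLevel_pos (hδ : δ ∈ Ioo (0 : ℝ) 1) (hu : 0 < u₀) (i : ℕ) : 0 < mainLevel δ u₀ i := by
  have h1 : 0 < 1 - δ := by linarith [hδ.2]
  have h2 : 0 < 1 + δ := by linarith [hδ.1]
  unfold mainLevel; positivity

lemma mainLevel_succ (i : ℕ) :
    mainLevel δ u₀ (i + 1) = (1 - δ) / (1 + δ) * mainLevel δ u₀ i := by
  unfold mainLevel; ring

lemma level_even {i : ℕ} (hi : i ≤ j) : level δ u₀ j (2 * i) = mainLevel δ u₀ i := by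
  unfold level
  rw [if_pos (by omega), if_pos (by simp)]
  congr 1; omega

lemma level_odd {i : ℕ} (hi : i ≤ j) :
    level δ u₀ j (2 * i + 1) = mainLevel δ u₀ i / (1 + δ) := by
  unfold level
  rw [if_pos (by omega), if_neg (by simp)]
  congr 2; omega

lemma level_pos (hδ : δ ∈ Ioo (0 : ℝ) 1) (hu : 0 < u₀) {m : ℕ} (hm : m ≤ 2 * j + 1) :
    0 < level δ u₀ j m := by
  have h2 : 0 < 1 + δ := by linarith [hδ.1]
  rcases Nat.even_or_odd' m with ⟨i, rfl | rfl⟩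
  · rw [level_even (by omega)]; exact mainLevel_pos hδ hu i
  · rw [level_odd (by omega)]; exact div_pos (mainLevel_pos hδ hu i) h2

lemma lowerThreshold_pos (hδ : δ ∈ Ioo (0 : ℝ) 1) (hu : 0 < u₀) {m : ℕ} (hm : m ≤ 2 * j + 1) :
    0 < lowerThreshold δ u₀ j m := by
  rw [lowerThreshold, if_pos hm]
  exact div_pos (level_pos hδ hu hm) (by linarith [hδ.1])

/-- Consecutive switching thresholds interlace strictly. -/
lemma threshold_chain (hδ : δ ∈ Ioo (0 : ℝ) 1) (hu : 0 < u₀) {m : ℕ} (hm : m ≤ 2 * j + 1) :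
    lowerThreshold δ u₀ j (m + 1) < lowerThreshold δ u₀ j m ∧
    lowerThreshold δ u₀ j m < upperThreshold δ u₀ j (m + 1) ∧
    upperThreshold δ u₀ j (m + 1) < upperThreshold δ u₀ j m := by
  obtain ⟨h0, h1⟩ := hδ
  have a1 : 0 < 1 - δ := by linarith
  have a2 : 0 < 1 + δ := by linarith
  rcases Nat.even_or_odd' m with ⟨i, rfl | rfl⟩
  · have hp := mainLevel_pos ⟨h0, h1⟩ hu i
    have e1 : lowerThreshold δ u₀ j (2 * i + 1) = mainLevel δ u₀ i / (1 + δ) / (1 + δ) := by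
      rw [lowerThreshold, if_pos (by omega), level_odd (by omega)]
    have e2 : lowerThreshold δ u₀ j (2 * i) = mainLevel δ u₀ i / (1 + δ) := by
      rw [lowerThreshold, if_pos (by omega), level_even (by omega)]
    have e3 : upperThreshold δ u₀ j (2 * i + 1) = mainLevel δ u₀ i / (1 + δ) / (1 - δ) := by
      rw [upperThreshold, if_neg (by omega), if_pos (by omega), level_odd (by omega)]
    -- Only an inequality: for `i = 0` the threshold is the artificial value `u₀/(1-δ) + 1`.
    have e4 : mainLevel δ u₀ i / (1 - δ) ≤ upperThreshold δ u₀ j (2 * i) := by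
      rw [upperThreshold]
      split_ifs with h
      · obtain rfl : i = 0 := by omega
        simp [mainLevel]
      · rw [level_even (by omega)]
    have hq : 0 < mainLevel δ u₀ i / (1 + δ) := by positivity
    have hlt : mainLevel δ u₀ i / (1 + δ) < mainLevel δ u₀ i := div_lt_self hp (by linarith)
    refine ⟨?_, ?_, ?_⟩
    · rw [e1, e2]; exact div_lt_self hq (by linarith)
    · rw [e2, e3, lt_div_iff₀ a1]; nlinarith
    · rw [e3]; refine lt_of_lt_of_le ?_ e4
      gcongr
  · have hp := mainLevel_pos ⟨h0, h1⟩ hu i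
    have hq : 0 < mainLevel δ u₀ i / (1 + δ) := by positivity
    have e2 : lowerThreshold δ u₀ j (2 * i + 1) = mainLevel δ u₀ i / (1 + δ) / (1 + δ) := by
      rw [lowerThreshold, if_pos (by omega), level_odd (by omega)]
    have e4 : upperThreshold δ u₀ j (2 * i + 1) = mainLevel δ u₀ i / (1 + δ) / (1 - δ) := by
      rw [upperThreshold, if_neg (by omega), if_pos (by omega), level_odd (by omega)]
    -- The next main level and the dead zone give the same value, since `u_{i+1}/(1-δ) = u_i/(1+δ)`.
    have e3 : upperThreshold δ u₀ j (2 * i + 1 + 1) = mainLevel δ u₀ i / (1 + δ) := by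
      rw [upperThreshold, if_neg (by omega)]
      split_ifs with h
      · rw [show 2 * i + 1 + 1 = 2 * (i + 1) by ring, level_even (by omega), mainLevel_succ]
        field_simp
      · obtain rfl : i = j := by omega
        rw [level_odd le_rfl]
    have e1 : lowerThreshold δ u₀ j (2 * i + 1 + 1) <
        mainLevel δ u₀ i / (1 + δ) / (1 + δ) := by
      rw [lowerThreshold]
      split_ifs with h
      · rw [show 2 * i + 1 + 1 = 2 * (i + 1) by ring, level_even (by omega), mainLevel_succ]
        gcongr
        rw [div_mul_eq_mul_div]
        gcongr
        nlinarith
      · have : 0 < mainLevel δ u₀ i / (1 + δ) / (1 + δ) := by positivity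
        linarith
    refine ⟨by rw [e2]; exact e1, ?_, ?_⟩
    · rw [e2, e3]; exact div_lt_self hq (by linarith)
    · rw [e3, e4, lt_div_iff₀ a1]; nlinarith

/-- A uniform gap between consecutive switching thresholds. -/
lemma exists_threshold_gap (hδ : δ ∈ Ioo (0 : ℝ) 1) (hu : 0 < u₀) :
    ∃ γ > 0, ∀ m ≤ 2 * j + 1,
      lowerThreshold δ u₀ j (m + 1) + γ < lowerThreshold δ u₀ j m ∧
      lowerThreshold δ u₀ j m + γ < upperThreshold δ u₀ j (m + 1) ∧
      upperThreshold δ u₀ j (m + 1) + γ < upperThreshold δ u₀ j m := by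
  suffices H : ∀ᶠ γ in 𝓝[>] (0 : ℝ), ∀ m ∈ Finset.range (2 * j + 2),
      lowerThreshold δ u₀ j (m + 1) + γ < lowerThreshold δ u₀ j m ∧
      lowerThreshold δ u₀ j m + γ < upperThreshold δ u₀ j (m + 1) ∧
      upperThreshold δ u₀ j (m + 1) + γ < upperThreshold δ u₀ j m by
    obtain ⟨γ, h1, h2⟩ := (H.and self_mem_nhdsWithin).exists
    exact ⟨γ, h2, fun m hm => h1 m (by simp; omega)⟩
  rw [Filter.eventually_all_finset]
  intro m hm
  obtain ⟨h1, h2, h3⟩ := threshold_chain hδ hu (m := m) (j := j) (by simp at hm; omega)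
  have key : ∀ a b : ℝ, a < b → ∀ᶠ γ in 𝓝[>] (0 : ℝ), a + γ < b := fun a b hab => by
    filter_upwards [Ioo_mem_nhdsGT (sub_pos.2 hab)] with γ hγ
    linarith [hγ.2]
  exact (key _ _ h1).and ((key _ _ h2).and (key _ _ h3))

/-- The artificial thresholds, `-1` in the dead zone and `u₀/(1-δ) + 1` in mode `0`, are never equal
to `|w|`. The transition law thus reduces to two comparisons, and `m - 1` is never truncated. -/
lemma nextMode_eq {m : ℕ} {w : ℝ} (hm : m ≤ 2 * j + 2) (hw : |w| ≤ u₀ / (1 - δ)) :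
    nextMode δ u₀ j m w = if |w| = lowerThreshold δ u₀ j m then m + 1
      else if |w| = upperThreshold δ u₀ j m then m - 1 else m := by
  have hw0 := abs_nonneg w
  unfold nextMode lowerThreshold upperThreshold
  rcases Nat.lt_or_ge (2 * j + 1) m with h | h
  · obtain rfl : m = 2 * j + 2 := by omega
    have h1 : ¬ 2 * j + 2 ≤ 2 * j + 1 := by omega
    have h2 : ¬ 2 * j + 2 = 0 := by omega
    have h3 : ¬ |w| = -1 := by linarith
    simp only [h1, h2, h3, false_and, and_false, if_false, true_and]
    rfl
  · rcases Nat.eq_zero_or_pos m with rfl | h0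
    · simp only [if_true, h, true_and]
      rw [if_neg (show ¬ ((1 : ℕ) ≤ 0 ∧ |w| = level δ u₀ j 0 / (1 - δ)) by omega),
        if_neg (by omega : ¬ (0 = 2 * j + 2 ∧ |w| = level δ u₀ j (0 - 1)))]
      rw [if_neg (by linarith : ¬ |w| = u₀ / (1 - δ) + 1)]
    · simp only [if_neg (by omega : ¬ m = 0), h, true_and, if_true,
        (by omega : 1 ≤ m)]
      rw [if_neg (by omega : ¬ (m = 2 * j + 2 ∧ |w| = level δ u₀ j (m - 1)))]

/-- After the transition, the input is strictly between the thresholds of the new mode. -/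
lemma InMode.nextMode_strict (hδ : δ ∈ Ioo (0 : ℝ) 1) (hu : 0 < u₀) {m : ℕ} {w : ℝ}
    (h : InMode δ u₀ j m w) :
    nextMode δ u₀ j m w ≤ 2 * j + 2 ∧
    lowerThreshold δ u₀ j (nextMode δ u₀ j m w) < |w| ∧
    |w| < upperThreshold δ u₀ j (nextMode δ u₀ j m w) := by
  rw [nextMode_eq h.le h.range]
  have hlow := h.lower
  have hup := h.upper
  have hle := h.le
  split_ifs with h1 h2
  · have hm : m ≤ 2 * j + 1 := by
      by_contra hc
      rw [lowerThreshold, if_neg hc] at h1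
      linarith [abs_nonneg w]
    obtain ⟨c1, c2, c3⟩ := threshold_chain hδ hu hm
    exact ⟨by omega, by rw [h1]; exact c1, by rw [h1]; exact c2⟩
  · have hm : m ≠ 0 := by
      rintro rfl
      rw [upperThreshold, if_pos rfl] at h2
      linarith [h.range]
    obtain ⟨m, rfl⟩ := Nat.exists_eq_succ_of_ne_zero hm
    obtain ⟨c1, c2, c3⟩ := threshold_chain hδ hu (m := m) (j := j) (by omega)
    simp only [Nat.succ_eq_add_one, Nat.add_sub_cancel] at *
    exact ⟨by omega, by rw [h2]; exact c2, by rw [h2]; exact c3⟩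
  · exact ⟨hle, lt_of_le_of_ne hlow (Ne.symm h1), lt_of_le_of_ne hup h2⟩

lemma InMode.nextMode (hδ : δ ∈ Ioo (0 : ℝ) 1) (hu : 0 < u₀) {m : ℕ} {w : ℝ}
    (h : InMode δ u₀ j m w) : InMode δ u₀ j (nextMode δ u₀ j m w) w := by
  obtain ⟨h1, h2, h3⟩ := h.nextMode_strict hδ hu
  exact ⟨h.range, h1, h2.le, h3.le⟩

/-- Strictly between the thresholds there is no switch. -/
lemma nextMode_of_strict {m : ℕ} {w : ℝ} (hm : m ≤ 2 * j + 2) (hw : |w| ≤ u₀ / (1 - δ))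
    (h1 : lowerThreshold δ u₀ j m < |w|) (h2 : |w| < upperThreshold δ u₀ j m) :
    nextMode δ u₀ j m w = m := by
  rw [nextMode_eq hm hw, if_neg h1.ne', if_neg h2.ne]

/-- After a genuine switch the input stays away from the thresholds of the new mode, uniformly. -/
lemma InMode.gap_of_switch {γ : ℝ} (hγ : ∀ m ≤ 2 * j + 1,
      lowerThreshold δ u₀ j (m + 1) + γ < lowerThreshold δ u₀ j m ∧
      lowerThreshold δ u₀ j m + γ < upperThreshold δ u₀ j (m + 1) ∧
      upperThreshold δ u₀ j (m + 1) + γ < upperThreshold δ u₀ j m)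
    {m : ℕ} {w : ℝ} (h : InMode δ u₀ j m w) (hs : _root_.nextMode δ u₀ j m w ≠ m) :
    lowerThreshold δ u₀ j (_root_.nextMode δ u₀ j m w) + γ < |w| ∧
    |w| + γ < upperThreshold δ u₀ j (_root_.nextMode δ u₀ j m w) := by
  rw [nextMode_eq h.le h.range] at hs ⊢
  have hle := h.le
  split_ifs at hs ⊢ with h1 h2
  · have hm : m ≤ 2 * j + 1 := by
      by_contra hc
      rw [lowerThreshold, if_neg hc] at h1
      linarith [abs_nonneg w]
    obtain ⟨c1, c2, c3⟩ := hγ m hm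
    exact ⟨by rw [h1]; exact c1, by rw [h1]; exact c2⟩
  · have hm : m ≠ 0 := by
      rintro rfl
      simp at hs
    obtain ⟨m, rfl⟩ := Nat.exists_eq_succ_of_ne_zero hm
    obtain ⟨c1, c2, c3⟩ := hγ m (by omega)
    simp only [Nat.succ_eq_add_one, Nat.add_sub_cancel] at *
    exact ⟨by rw [h2]; exact c2, by rw [h2]; exact c3⟩
  · exact absurd rfl hs

lemma mainLevel_antitone (hδ : δ ∈ Ioo (0 : ℝ) 1) (hu : 0 < u₀) :
    Antitone (mainLevel δ u₀) := by
  refine antitone_nat_of_succ_le fun i => ?_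
  rw [mainLevel_succ]
  have := mainLevel_pos hδ hu i
  have h : (1 - δ) / (1 + δ) ≤ 1 := by
    rw [div_le_one (by linarith [hδ.1])]; linarith [hδ.1]
  nlinarith

/-- The choice of `ρ` makes the initialization bands adjacent: they neither overlap nor leave gaps,
whence existence and uniqueness of the initial mode. -/
lemma mainLevel_succ_div (hδ : δ ∈ Ioo (0 : ℝ) 1) (i : ℕ) :
    1 / (1 - δ) * mainLevel δ u₀ (i + 1) = 1 / (1 + δ) * mainLevel δ u₀ i := by
  have h1 : 1 - δ ≠ 0 := by linarith [hδ.2]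
  have h2 : 1 + δ ≠ 0 := by linarith [hδ.1]
  rw [mainLevel_succ]; field_simp

/-- By induction on `j`: one more level splits the former dead zone into a band and a smaller dead
zone. -/
lemma exists_initialMode (hδ : δ ∈ Ioo (0 : ℝ) 1) {w : ℝ} (hw : |w| ≤ u₀ / (1 - δ)) :
    ∃ k, IsInitialMode δ u₀ j w k := by
  suffices H : (∃ i ≤ j, 1 / (1 + δ) * mainLevel δ u₀ i < |w| ∧
      |w| ≤ 1 / (1 - δ) * mainLevel δ u₀ i) ∨ |w| ≤ 1 / (1 + δ) * mainLevel δ u₀ j by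
    rcases H with ⟨i, hi, h⟩ | h
    · exact ⟨2 * i, Or.inl ⟨i, hi, rfl, h⟩⟩
    · exact ⟨2 * j + 2, Or.inr ⟨rfl, h⟩⟩
  induction j with
  | zero =>
    rcases le_or_gt |w| (1 / (1 + δ) * mainLevel δ u₀ 0) with h | h
    · exact Or.inr h
    · refine Or.inl ⟨0, le_rfl, h, ?_⟩
      simpa [mainLevel, div_eq_inv_mul] using hw
  | succ j ih =>
    rcases ih with ⟨i, hi, h⟩ | h
    · exact Or.inl ⟨i, by omega, h⟩
    · rcases le_or_gt |w| (1 / (1 + δ) * mainLevel δ u₀ (j + 1)) with h' | h'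
      · exact Or.inr h'
      · exact Or.inl ⟨j + 1, le_rfl, h', by rwa [mainLevel_succ_div hδ]⟩

lemma IsInitialMode.unique (hδ : δ ∈ Ioo (0 : ℝ) 1) (hu : 0 < u₀) {w : ℝ} {k k' : ℕ}
    (h : IsInitialMode δ u₀ j w k) (h' : IsInitialMode δ u₀ j w k') : k = k' := by
  have hp : 0 < 1 / (1 + δ) := by have := hδ.1; positivity
  have key : ∀ i i' : ℕ, i < i' → 1 / (1 + δ) * mainLevel δ u₀ i < |w| →
      |w| ≤ 1 / (1 - δ) * mainLevel δ u₀ i' → False := fun i i' hi h1 h2 => by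
    obtain ⟨l, rfl⟩ := Nat.exists_eq_add_of_lt hi
    rw [mainLevel_succ_div hδ] at h2
    have := mul_le_mul_of_nonneg_left
      (mainLevel_antitone hδ hu (show i ≤ i + l by omega)) hp.le
    linarith
  have key' : ∀ i ≤ j, 1 / (1 + δ) * mainLevel δ u₀ i < |w| →
      |w| ≤ 1 / (1 + δ) * mainLevel δ u₀ j → False := fun i hi h1 h2 => by
    have := mul_le_mul_of_nonneg_left (mainLevel_antitone hδ hu hi) hp.le
    linarith
  rcases h with ⟨i, hi, rfl, h1, h2⟩ | ⟨rfl, h1⟩ <;>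
    rcases h' with ⟨i', hi', rfl, h1', h2'⟩ | ⟨rfl, h1'⟩
  · rcases lt_trichotomy i i' with h | h | h
    · exact (key _ _ h h1 h2').elim
    · rw [h]
    · exact (key _ _ h h1' h2).elim
  · exact (key' _ hi h1 h1').elim
  · exact (key' _ hi' h1' h1).elim
  · rfl

lemma IsInitialMode.inMode {w : ℝ} {k : ℕ}
    (hw : |w| ≤ u₀ / (1 - δ)) (h : IsInitialMode δ u₀ j w k) : InMode δ u₀ j k w := by
  rcases h with ⟨i, hi, rfl, h1, h2⟩ | ⟨rfl, h1⟩
  · refine ⟨hw, by omega, ?_, ?_⟩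
    · rw [lowerThreshold, if_pos (by omega), level_even hi, div_eq_inv_mul, inv_eq_one_div]
      exact h1.le
    · rw [upperThreshold]
      split_ifs with h
      · linarith
      · rw [level_even hi, div_eq_inv_mul, inv_eq_one_div]; exact h2
      · omega
  · refine ⟨hw, le_rfl, ?_, ?_⟩
    · rw [lowerThreshold, if_neg (by omega)]
      linarith [abs_nonneg w]
    · rw [upperThreshold, if_neg (by omega), if_neg (by omega), level_odd le_rfl, div_eq_inv_mul,
        inv_eq_one_div]
      exact h1

/-- The gain of the quantizer in mode `m`. -/
def quantGain (δ u₀ : ℝ) (j m : ℕ) (w : ℝ) : ℝ :=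
  if m ≤ 2 * j + 1 then level δ u₀ j m / |w| else 1

/-- The output of the quantizer in mode `m`. -/
def quantOut (δ u₀ : ℝ) (j m : ℕ) (w : ℝ) : ℝ := Real.sign w * level δ u₀ j m

lemma sign_mul_eq {w : ℝ} (hw : w ≠ 0) (a : ℝ) : Real.sign w * a = a / |w| * w := by
  rcases lt_or_gt_of_ne hw with h | h
  · rw [Real.sign_of_neg h, abs_of_neg h]; field_simp
  · rw [Real.sign_of_pos h, abs_of_pos h]; field_simp

lemma InMode.pos (hδ : δ ∈ Ioo (0 : ℝ) 1) (hu : 0 < u₀) {m : ℕ} {w : ℝ}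
    (h : InMode δ u₀ j m w) (hm : m ≤ 2 * j + 1) : 0 < |w| :=
  (lowerThreshold_pos hδ hu hm).trans_le h.lower

lemma InMode.quantOut_eq (hδ : δ ∈ Ioo (0 : ℝ) 1) (hu : 0 < u₀) {m : ℕ} {w : ℝ}
    (h : InMode δ u₀ j m w) (hm : m ≤ 2 * j + 1) :
    quantOut δ u₀ j m w = quantGain δ u₀ j m w * w := by
  rw [quantOut, quantGain, if_pos hm, sign_mul_eq (abs_pos.1 (h.pos hδ hu hm))]

lemma quantOut_dead {m : ℕ} {w : ℝ} (hm : ¬ m ≤ 2 * j + 1) : quantOut δ u₀ j m w = 0 := by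
  rw [quantOut, level, if_neg hm, mul_zero]

/-- The thresholds `ũ_m/(1+δ)` and `ũ_m/(1-δ)` are exactly the sector bounds. The value `1` in the
dead zone is a convention that stays in the sector. -/
lemma InMode.quantGain_mem (hδ : δ ∈ Ioo (0 : ℝ) 1) (hu : 0 < u₀) {m : ℕ} {w : ℝ}
    (h : InMode δ u₀ j m w) : quantGain δ u₀ j m w ∈ Icc (1 - δ) (1 + δ) := by
  obtain ⟨h0, h1⟩ := hδ
  have a1 : 0 < 1 - δ := by linarith
  have a2 : 0 < 1 + δ := by linarith
  rw [quantGain]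
  split_ifs with hm
  · have hp := h.pos ⟨h0, h1⟩ hu hm
    have hl := h.lower
    have hup := h.upper
    rw [lowerThreshold, if_pos hm, div_le_iff₀ a2] at hl
    rw [mem_Icc, le_div_iff₀ hp, div_le_iff₀ hp]
    refine ⟨?_, by linarith⟩
    rw [upperThreshold] at hup
    -- In mode `0` the threshold is too weak; the range of the quantizer gives the bound instead.
    split_ifs at hup with h0
    · subst h0
      have := h.range
      rw [le_div_iff₀ a1] at this
      have e : level δ u₀ j 0 = u₀ := by
        simpa [mainLevel] using level_even (δ := δ) (u₀ := u₀) (Nat.zero_le j)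
      rw [e]; linarith
    · rw [le_div_iff₀ a1] at hup; linarith
  · constructor <;> linarith

/-- Only the dead zone contributes: the output is `0` and the conventional gain `1`, so the error is
`|w| ≤ ũ_{2j+1} ≤ u_j`. It is the sole defect that has to be made small. -/
lemma InMode.abs_quantOut_sub_le (hδ : δ ∈ Ioo (0 : ℝ) 1) (hu : 0 < u₀) {m : ℕ} {w : ℝ}
    (h : InMode δ u₀ j m w) :
    |quantOut δ u₀ j m w - quantGain δ u₀ j m w * w| ≤ mainLevel δ u₀ j := by
  have hp := mainLevel_pos hδ hu j
  by_cases hm : m ≤ 2 * j + 1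
  · rw [h.quantOut_eq hδ hu hm, sub_self, abs_zero]; exact hp.le
  · rw [quantOut_dead hm, quantGain, if_neg hm, one_mul, zero_sub, abs_neg]
    have := h.upper
    rw [upperThreshold, if_neg (by omega), if_neg hm, level_odd le_rfl] at this
    exact this.trans (div_le_self hp.le (by linarith [hδ.1]))

lemma continuousOn_quantGain (hδ : δ ∈ Ioo (0 : ℝ) 1) (hu : 0 < u₀) {m : ℕ} {w : ℝ → ℝ}
    {s : Set ℝ} (hw : ContinuousOn w s) (h : ∀ t ∈ s, InMode δ u₀ j m (w t)) :
    ContinuousOn (fun t => quantGain δ u₀ j m (w t)) s := by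
  by_cases hm : m ≤ 2 * j + 1
  · simp only [quantGain, if_pos hm]
    exact continuousOn_const.div hw.abs fun t ht => ((h t ht).pos hδ hu hm).ne'
  · simp only [quantGain, if_neg hm]
    exact continuousOn_const

/-- The jump of the sign at `0` is harmless: in a mode `m ≤ 2j+1` the input is bounded away from
`0`, and in the dead zone the output vanishes. -/
lemma continuousOn_quantOut (hδ : δ ∈ Ioo (0 : ℝ) 1) (hu : 0 < u₀) {m : ℕ} {w : ℝ → ℝ}
    {s : Set ℝ} (hw : ContinuousOn w s) (h : ∀ t ∈ s, InMode δ u₀ j m (w t)) :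
    ContinuousOn (fun t => quantOut δ u₀ j m (w t)) s := by
  by_cases hm : m ≤ 2 * j + 1
  · refine ((continuousOn_quantGain hδ hu hw h).mul hw).congr fun t ht => ?_
    exact (h t ht).quantOut_eq hδ hu hm
  · simp only [quantOut_dead hm]
    exact continuousOn_const

lemma abs_quantOut_le (hδ : δ ∈ Ioo (0 : ℝ) 1) (hu : 0 < u₀) (m : ℕ) (w : ℝ) :
    |quantOut δ u₀ j m w| ≤ u₀ := by
  have hl : |level δ u₀ j m| ≤ u₀ := by
    by_cases hm : m ≤ 2 * j + 1
    · rw [abs_of_pos (level_pos hδ hu hm)]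
      have hb : ∀ i, mainLevel δ u₀ i ≤ u₀ := fun i => by
        simpa [mainLevel] using mainLevel_antitone hδ hu (Nat.zero_le i)
      rcases Nat.even_or_odd' m with ⟨i, rfl | rfl⟩
      · rw [level_even (by omega)]; exact hb i
      · rw [level_odd (by omega)]
        exact (div_le_self (mainLevel_pos hδ hu i).le (by linarith [hδ.1])).trans (hb i)
    · rw [level, if_neg hm, abs_zero]; exact hu.le
  rw [quantOut, abs_mul]
  have hs : |Real.sign w| ≤ 1 := by
    rcases Real.sign_apply_eq w with h | h | h <;> rw [h] <;> norm_num
  nlinarith [abs_nonneg (Real.sign w), abs_nonneg (level δ u₀ j m)]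

end Quantizer

end

/-! ### Uniqueness of hysteretic solutions. -/

section

/-- Continuous induction on a closed interval. -/
lemma forall_Icc_of_continuous_induction {P : ℝ → Prop} {a b : ℝ} (ha : P a)
    (hleft : ∀ t ∈ Ioc a b, (∀ s ∈ Ico a t, P s) → P t)
    (hright : ∀ t ∈ Ico a b, (∀ s ∈ Icc a t, P s) → ∀ᶠ s in 𝓝[>] t, P s) :
    ∀ t ∈ Icc a b, P t := by
  by_contra! hc
  obtain ⟨b', hb', hPb'⟩ := hc
  set B : Set ℝ := {t | t ∈ Icc a b ∧ ¬ P t} with hB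
  have hne : B.Nonempty := ⟨b', hb', hPb'⟩
  have hbdd : BddBelow B := ⟨a, fun t ht => ht.1.1⟩
  have h0a : a ≤ sInf B := le_csInf hne fun t ht => ht.1.1
  have h0b : sInf B ≤ b' := csInf_le hbdd ⟨hb', hPb'⟩
  have hlt : ∀ s ∈ Ico a (sInf B), P s := fun s hs => by
    by_contra h
    exact absurd (csInf_le hbdd ⟨⟨hs.1, by linarith [hs.2, hb'.2]⟩, h⟩) (not_le.2 hs.2)
  have hP : P (sInf B) := by
    rcases h0a.eq_or_lt with h | h
    · rwa [← h]
    · exact hleft _ ⟨h, h0b.trans hb'.2⟩ hlt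
  have h0b' : sInf B < b' := lt_of_le_of_ne h0b fun h => hPb' (h ▸ hP)
  have hev := hright (sInf B) ⟨h0a, h0b'.trans_le hb'.2⟩ fun s hs => by
    rcases hs.2.eq_or_lt with h | h
    · rwa [h]
    · exact hlt s ⟨hs.1, h⟩
  obtain ⟨c, hc, hcs⟩ := (mem_nhdsGT_iff_exists_Ioo_subset' h0b').1 hev
  have : c ≤ sInf B := le_csInf hne fun t ht => by
    by_contra! h
    rcases (csInf_le hbdd ht).eq_or_lt with h' | h'
    · exact ht.2 (h' ▸ hP)
    · exact ht.2 (hcs ⟨h', h⟩)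
  exact absurd hc (not_lt.2 this)

variable {n : ℕ} {f g : EuclideanSpace ℝ (Fin n) → EuclideanSpace ℝ (Fin n)}
  {z : EuclideanSpace ℝ (Fin n) → ℝ} {τ δ u₀ : ℝ} {j : ℕ}

/-- Local uniqueness to the right for `ẋ = f(x) + c(t) g(x)` with a bounded control `c`. -/
lemma eventually_eq_of_ode (hf : LocallyLipschitz f) (hg : LocallyLipschitz g)
    {c : ℝ → ℝ} {C t₀ : ℝ} (hc : ∀ t, |c t| ≤ C) {x y : ℝ → EuclideanSpace ℝ (Fin n)}
    (hx : ∀ᶠ t in 𝓝[≥] t₀, ContinuousWithinAt x (Ici t₀) t ∧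
      HasDerivWithinAt x (f (x t) + c t • g (x t)) (Ici t) t)
    (hy : ∀ᶠ t in 𝓝[≥] t₀, ContinuousWithinAt y (Ici t₀) t ∧
      HasDerivWithinAt y (f (y t) + c t • g (y t)) (Ici t) t)
    (h0 : x t₀ = y t₀) : ∀ᶠ t in 𝓝[≥] t₀, x t = y t := by
  obtain ⟨Kf, s, hs, hKf⟩ := hf (x t₀)
  obtain ⟨Kg, s', hs', hKg⟩ := hg (x t₀)
  have hC : 0 ≤ C := (abs_nonneg _).trans (hc 0)
  have hself : t₀ ∈ Ici t₀ := self_mem_Ici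
  have hxs : ∀ᶠ t in 𝓝[≥] t₀, x t ∈ s ∩ s' :=
    (hx.self_of_nhdsWithin hself).1 (inter_mem hs hs')
  have hys : ∀ᶠ t in 𝓝[≥] t₀, y t ∈ s ∩ s' :=
    (hy.self_of_nhdsWithin hself).1 (by rw [← h0]; exact inter_mem hs hs')
  obtain ⟨b, hb, hbs⟩ := (mem_nhdsGE_iff_exists_Icc_subset).1
    ((hx.and hy).and (hxs.and hys))
  -- The control is common to both solutions and enters only through its bound, so no regularity in
  -- time is needed.
  have hlip : ∀ t ∈ Ico t₀ b, LipschitzOnWith (Kf + C.toNNReal * Kg)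
      (fun p => f p + c t • g p) (s ∩ s') := fun t _ => by
    refine (hKf.mono inter_subset_left).add ?_
    refine LipschitzOnWith.of_dist_le_mul fun p hp q hq => ?_
    have := hKg.dist_le_mul p hp.2 q hq.2
    rw [dist_smul₀, Real.norm_eq_abs, NNReal.coe_mul, Real.coe_toNNReal C hC, mul_assoc]
    exact mul_le_mul (hc t) this dist_nonneg hC
  have key := ODE_solution_unique_of_mem_Icc_right (v := fun t p => f p + c t • g p)
    (s := fun _ => s ∩ s') (a := t₀) (b := b) (f := x) (g := y) hlip
    (fun t ht => ((hbs ht).1.1.1).mono Icc_subset_Ici_self)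
    (fun t ht => (hbs (Ico_subset_Icc_self ht)).1.1.2)
    (fun t ht => (hbs (Ico_subset_Icc_self ht)).2.1)
    (fun t ht => ((hbs ht).1.2.1).mono Icc_subset_Ici_self)
    (fun t ht => (hbs (Ico_subset_Icc_self ht)).1.2.2)
    (fun t ht => (hbs (Ico_subset_Icc_self ht)).2.2) h0
  exact mem_of_superset (Icc_mem_nhdsGE hb) key

lemma eventually_nhds_coe_lt {T : EReal} {t : ℝ} (ht : (t : EReal) < T) :
    ∀ᶠ s : ℝ in 𝓝 t, (s : EReal) < T :=
  continuous_coe_real_ereal.continuousAt.eventually (gt_mem_nhds ht)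

lemma IsHystereticSolution.continuousWithinAt_Ici {φ : ℝ → EuclideanSpace ℝ (Fin n)} {T : EReal}
    {x : ℝ → EuclideanSpace ℝ (Fin n)} {k : ℝ → ℕ}
    (h : IsHystereticSolution f g z τ δ u₀ j φ T x k) (hτ : 0 ≤ τ) {t₀ t : ℝ} (h0 : 0 ≤ t₀)
    (ht₀ : t₀ ≤ t) (ht : (t : EReal) < T) : ContinuousWithinAt x (Ici t₀) t := by
  refine (h.continuousOn t ⟨by linarith, ht⟩).mono_of_mem_nhdsWithin ?_
  filter_upwards [nhdsWithin_le_nhds (eventually_nhds_coe_lt ht), self_mem_nhdsWithin] with s hs hs'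
  exact ⟨by have : t₀ ≤ s := hs'; linarith, hs⟩

/-- Two hysteretic solutions with the same initial function agree where both are defined. -/
theorem IsHystereticSolution.eq_of_lt (hf : LocallyLipschitz f) (hg : LocallyLipschitz g)
    (hτ : 0 < τ) (hδ : δ ∈ Ioo (0 : ℝ) 1) (hu : 0 < u₀)
    {φ : ℝ → EuclideanSpace ℝ (Fin n)} {T T' : EReal}
    {x x' : ℝ → EuclideanSpace ℝ (Fin n)} {k k' : ℝ → ℕ}
    (h : IsHystereticSolution f g z τ δ u₀ j φ T x k)
    (h' : IsHystereticSolution f g z τ δ u₀ j φ T' x' k') {b : ℝ} (hb0 : 0 ≤ b)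
    (hb : (b : EReal) < T) (hb' : (b : EReal) < T') : x b = x' b ∧ k b = k' b := by
  have hT : ∀ t ≤ b, (t : EReal) < T := fun t ht => (EReal.coe_le_coe_iff.2 ht).trans_lt hb
  have hT' : ∀ t ≤ b, (t : EReal) < T' := fun t ht => (EReal.coe_le_coe_iff.2 ht).trans_lt hb'
  have hist : ∀ t ∈ Icc (-(2 * τ)) 0, x t = x' t := fun t ht => by
    rw [h.history t ht, h'.history t ht]
  suffices H : ∀ t ∈ Icc 0 b, x t = x' t ∧ k t = k' t from H b ⟨hb0, le_rfl⟩
  refine forall_Icc_of_continuous_induction ?_ ?_ ?_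
  · have e : x (0 - τ) = x' (0 - τ) := hist _ ⟨by linarith, by linarith⟩
    refine ⟨hist 0 ⟨by linarith, le_rfl⟩, ?_⟩
    have h1 := h.initial
    rw [e] at h1
    exact h1.unique hδ hu h'.initial
  · intro t ht hs
    have hev : ∀ᶠ s in 𝓝[<] t, x s = x' s ∧ k s = k' s := by
      filter_upwards [Ico_mem_nhdsLT ht.1] with s hs' using hs s hs'
    have c : ∀ {T : EReal} {x : ℝ → EuclideanSpace ℝ (Fin n)} {k : ℝ → ℕ},
        IsHystereticSolution f g z τ δ u₀ j φ T x k → (t : EReal) < T →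
        Tendsto x (𝓝[<] t) (𝓝 (x t)) := fun {T x k} h hT => by
      refine (h.continuousOn t ⟨by linarith [ht.1], hT⟩).mono_left
        (nhdsWithin_le_of_mem ?_)
      filter_upwards [Ico_mem_nhdsLT ht.1] with s hs'
      exact ⟨by linarith [hs'.1], (EReal.coe_lt_coe_iff.2 hs'.2).trans hT⟩
    refine ⟨tendsto_nhds_unique ((c h (hT t ht.2)).congr' ?_) (c h' (hT' t ht.2)), ?_⟩
    · filter_upwards [hev] with s hs using hs.1
    · obtain ⟨s, ⟨h1, h2⟩, h3⟩ := ((h.left_const t ht.1 (hT t ht.2)).and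
        (h'.left_const t ht.1 (hT' t ht.2)) |>.and hev).exists
      rw [← h1, ← h2, h3.2]
  · intro t ht hs
    have hpast : ∀ s ∈ Icc (-(2 * τ)) t, x s = x' s := fun s hs' => by
      rcases le_total s 0 with h0 | h0
      · exact hist s ⟨hs'.1, h0⟩
      · exact (hs s ⟨h0, hs'.2⟩).1
    have hk : ∀ᶠ s in 𝓝[>] t, k s = k' s := by
      have e : x (t - τ) = x' (t - τ) := hpast _ ⟨by linarith [ht.1], by linarith⟩
      filter_upwards [h.transition t ht.1 (hT t ht.2.le), h'.transition t ht.1 (hT' t ht.2.le)]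
        with s h1 h2
      rw [h1, h2, e, (hs t ⟨ht.1, le_rfl⟩).2]
    have hk' : ∀ᶠ s in 𝓝[≥] t, k s = k' s := by
      rw [eventually_nhdsWithin_iff] at hk ⊢
      filter_upwards [hk] with s hs' hts
      rcases (show t ≤ s from hts).eq_or_lt with h0 | h0
      · rw [← h0]; exact (hs t ⟨ht.1, le_rfl⟩).2
      · exact hs' h0
    -- Before `t + τ` the delayed state lies in the past of `t`, where the solutions already agree;
    -- both then solve one equation with the same control.
    have hnear : ∀ᶠ s in 𝓝[≥] t, s ∈ Ico t (min b (t + τ)) :=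
      Ico_mem_nhdsGE (lt_min ht.2 (by linarith))
    have hdom : ∀ {T : EReal} {x : ℝ → EuclideanSpace ℝ (Fin n)} {k : ℝ → ℕ},
        IsHystereticSolution f g z τ δ u₀ j φ T x k → (∀ s ≤ b, (s : EReal) < T) →
        ∀ s ∈ Ico t (min b (t + τ)), ContinuousWithinAt x (Ici t) s ∧
          HasDerivWithinAt x (f (x s) + quantOut δ u₀ j
            (nextMode δ u₀ j (k s) (z (x (s - τ)))) (z (x (s - τ))) • g (x s)) (Ici s) s := by
      intro T x k h hT s hs'
      have hsb : s ≤ b := hs'.2.le.trans (min_le_left _ _)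
      exact ⟨h.continuousWithinAt_Ici hτ.le ht.1 hs'.1 (hT s hsb),
        h.ode s (ht.1.trans hs'.1) (hT s hsb)⟩
    have hxe := eventually_eq_of_ode hf hg (t₀ := t) (C := u₀) (x := x) (y := x')
      (c := fun s => quantOut δ u₀ j
            (nextMode δ u₀ j (k s) (z (x (s - τ)))) (z (x (s - τ))))
      (fun s => abs_quantOut_le hδ hu _ _)
      (by filter_upwards [hnear] with s hs' using hdom h hT s hs')
      (by
        filter_upwards [hnear, hk'] with s hs' hks
        have e : x (s - τ) = x' (s - τ) :=
          hpast _ ⟨by linarith [ht.1, hs'.1], by linarith [hs'.2.trans_le (min_le_right _ _)]⟩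
        rw [hks, e]
        exact hdom h' hT' s hs')
      (hs t ⟨ht.1, le_rfl⟩).1
    filter_upwards [nhdsWithin_mono _ Ioi_subset_Ici_self hxe, hk] with s h1 h2 using ⟨h1, h2⟩

end

/-! ### Global existence for bounded Lipschitz data. -/

noncomputable section

/-- Global existence for `ẋ = f(x) + c(t) g(x)` with `f`, `g` bounded and Lipschitz. -/
lemma exists_solution_of_bounded_lipschitz {E : Type*} [NormedAddCommGroup E] [NormedSpace ℝ E]
    [CompleteSpace E] {f g : E → E} {K : NNReal} {B C : ℝ} (hf : LipschitzWith K f)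
    (hg : LipschitzWith K g) (hfB : ∀ p, ‖f p‖ ≤ B) (hgB : ∀ p, ‖g p‖ ≤ B) {a b : ℝ} (hab : a ≤ b)
    {c : ℝ → ℝ} (hc : ContinuousOn c (Icc a b)) (hcC : ∀ t, |c t| ≤ C) (p : E) :
    ∃ y : ℝ → E, y a = p ∧ ContinuousOn y (Icc a b) ∧
      ∀ t ∈ Ico a b, HasDerivWithinAt y (f (y t) + c t • g (y t)) (Ici t) t := by
  have hB : 0 ≤ B := (norm_nonneg _).trans (hfB p)
  have hC : 0 ≤ C := (abs_nonneg _).trans (hcC 0)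
  have hL : 0 ≤ B + C * B := by positivity
  have hba : 0 ≤ b - a := sub_nonneg.2 hab
  -- The speed is at most `B + C B`, so the ball of radius `(B + C B)(b - a)` is not left before `b`
  -- and one Picard-Lindelöf step covers `[a, b]`.
  have hpl : IsPicardLindelof (fun t q => f q + c t • g q) (⟨a, le_rfl, hab⟩ : Icc a b) p
      (((B + C * B) * (b - a)).toNNReal) 0 (B + C * B).toNNReal (K + C.toNNReal * K) := by
    refine ⟨fun t _ => ?_, fun q _ => ?_, fun t _ q _ => ?_, ?_⟩
    · refine (hf.add (LipschitzWith.of_dist_le_mul fun q q' => ?_)).lipschitzOnWith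
      rw [dist_smul₀, Real.norm_eq_abs, NNReal.coe_mul, Real.coe_toNNReal C hC, mul_assoc]
      exact mul_le_mul (hcC t) (hg.dist_le_mul q q') dist_nonneg hC
    · exact continuousOn_const.add (hc.smul continuousOn_const)
    · rw [Real.coe_toNNReal _ hL]
      refine (norm_add_le _ _).trans (add_le_add (hfB q) ?_)
      rw [norm_smul, Real.norm_eq_abs]
      exact mul_le_mul (hcC t) (hgB q) (norm_nonneg _) hC
    · rw [Real.coe_toNNReal _ hL, Real.coe_toNNReal _ (by positivity)]
      simp [hba]
  obtain ⟨y, hy0, hy⟩ := hpl.exists_eq_forall_mem_Icc_hasDerivWithinAt₀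
  exact ⟨y, hy0, fun t ht => (hy t ht).continuousWithinAt, fun t ht =>
    (hy t (Ico_subset_Icc_self ht)).mono_of_mem_nhdsWithin (Icc_mem_nhdsGE_of_mem ht)⟩

/-- `(x, k)` is a hysteretic solution on the closed interval `[-2τ, a]` whose index is compatible
with the quantizer input at all times. -/
structure IsSolutionUpTo {n : ℕ}
    (f g : EuclideanSpace ℝ (Fin n) → EuclideanSpace ℝ (Fin n))
    (z : EuclideanSpace ℝ (Fin n) → ℝ) (τ δ u₀ : ℝ) (j : ℕ)
    (φ : ℝ → EuclideanSpace ℝ (Fin n)) (a : ℝ)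
    (x : ℝ → EuclideanSpace ℝ (Fin n)) (k : ℝ → ℕ) : Prop where
  history : ∀ t ∈ Icc (-(2 * τ)) 0, x t = φ t
  continuousOn : ContinuousOn x (Icc (-(2 * τ)) a)
  initial : IsInitialMode δ u₀ j (z (x (0 - τ))) (k 0)
  left_const : ∀ t ∈ Ioc 0 a, ∀ᶠ s in 𝓝[<] t, k s = k t
  transition : ∀ t ∈ Ico 0 a, ∀ᶠ s in 𝓝[>] t, k s = nextMode δ u₀ j (k t) (z (x (t - τ)))
  ode : ∀ t ∈ Ico 0 a, HasDerivWithinAt x (f (x t) + quantOut δ u₀ j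
    (nextMode δ u₀ j (k t) (z (x (t - τ)))) (z (x (t - τ))) • g (x t)) (Ici t) t
  inMode : ∀ t ∈ Icc 0 a, InMode δ u₀ j (k t) (z (x (t - τ)))

variable {n : ℕ} {f g : EuclideanSpace ℝ (Fin n) → EuclideanSpace ℝ (Fin n)}
  {z : EuclideanSpace ℝ (Fin n) → ℝ} {τ δ u₀ : ℝ} {j : ℕ}
  {φ : ℝ → EuclideanSpace ℝ (Fin n)} {a : ℝ} {x : ℝ → EuclideanSpace ℝ (Fin n)} {k : ℝ → ℕ}

lemma IsSolutionUpTo.isHystereticSolution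
    (h : IsSolutionUpTo f g z τ δ u₀ j φ a x k) :
    IsHystereticSolution f g z τ δ u₀ j φ a x k where
  history := h.history
  continuousOn := h.continuousOn.mono fun _ ht => ⟨ht.1, (EReal.coe_lt_coe_iff.1 ht.2).le⟩
  in_range t h0 ht := (h.inMode t ⟨h0, (EReal.coe_lt_coe_iff.1 ht).le⟩).range
  initial := h.initial
  left_const t h0 ht := h.left_const t ⟨h0, (EReal.coe_lt_coe_iff.1 ht).le⟩
  transition t h0 ht := h.transition t ⟨h0, EReal.coe_lt_coe_iff.1 ht⟩
  ode t h0 ht := h.ode t ⟨h0, EReal.coe_lt_coe_iff.1 ht⟩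

/-- Extension of a solution over an interval without switches in the interior. -/
lemma IsSolutionUpTo.extend {K : NNReal} {B : ℝ} (hf : LipschitzWith K f)
    (hg : LipschitzWith K g) (hfB : ∀ p, ‖f p‖ ≤ B) (hgB : ∀ p, ‖g p‖ ≤ B) (hz : Continuous z)
    (hτ : 0 < τ) (hδ : δ ∈ Ioo (0 : ℝ) 1) (hu : 0 < u₀)
    (h : IsSolutionUpTo f g z τ δ u₀ j φ a x k) {b : ℝ} (ha : 0 ≤ a) (hab : a < b)
    (hb : b ≤ a + τ) {m : ℕ} (hm : nextMode δ u₀ j (k a) (z (x (a - τ))) = m)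
    (hconst : ∀ t ∈ Ioo a b, nextMode δ u₀ j m (z (x (t - τ))) = m)
    (hmode : ∀ t ∈ Icc a b, InMode δ u₀ j m (z (x (t - τ)))) :
    ∃ x' k', IsSolutionUpTo f g z τ δ u₀ j φ b x' k' ∧ (∀ t ≤ a, x' t = x t) ∧ k' b = m := by
  -- Since `b ≤ a + τ`, the delayed input on `[a, b]` involves only the part of `x` already built:
  -- the control is a known function of time.
  have hw : ContinuousOn (fun t => z (x (t - τ))) (Icc a b) :=
    hz.comp_continuousOn (h.continuousOn.comp (by fun_prop)
      fun t ht => ⟨by linarith [ht.1], by linarith [ht.2]⟩)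
  obtain ⟨y, hya, hyc, hyd⟩ := exists_solution_of_bounded_lipschitz hf hg hfB hgB hab.le
    (c := fun t => quantOut δ u₀ j m (z (x (t - τ)))) (continuousOn_quantOut hδ hu hw hmode)
    (fun t => abs_quantOut_le hδ hu _ _) (x a)
  set x' : ℝ → EuclideanSpace ℝ (Fin n) := fun t => if t ≤ a then x t else y t with hx'
  -- At `a` itself the index keeps its value before the switch.
  set k' : ℝ → ℕ := fun t => if t ≤ a then k t else m with hk'
  have ex : ∀ t ≤ a, x' t = x t := fun t ht => if_pos ht
  have ey : ∀ t, a ≤ t → x' t = y t := fun t ht => by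
    rcases ht.eq_or_lt with rfl | h1
    · rw [ex _ le_rfl, hya]
    · exact if_neg (not_le.2 h1)
  have ek : ∀ t ≤ a, k' t = k t := fun t ht => if_pos ht
  have em : ∀ t, a < t → k' t = m := fun t ht => if_neg (not_le.2 ht)
  have ew : ∀ t ≤ b, x' (t - τ) = x (t - τ) := fun t ht => ex _ (by linarith)
  refine ⟨x', k', ⟨?_, ?_, ?_, ?_, ?_, ?_, ?_⟩, ex, em b hab⟩
  · intro t ht
    rw [ex t (ht.2.trans ha), h.history t ht]
  · rw [← Icc_union_Icc_eq_Icc (by linarith : -(2 * τ) ≤ a) hab.le]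
    exact ContinuousOn.union_of_isClosed (h.continuousOn.congr fun t ht => ex t ht.2)
      (hyc.congr fun t ht => ey t ht.1) isClosed_Icc isClosed_Icc
  · rw [ew 0 (by linarith), ek 0 ha]
    exact h.initial
  · intro t ht
    rcases le_or_gt t a with h1 | h1
    · rw [ek t h1]
      filter_upwards [h.left_const t ⟨ht.1, h1⟩, self_mem_nhdsWithin] with s hs hs'
      rw [ek s ((le_of_lt hs').trans h1), hs]
    · rw [em t h1]
      filter_upwards [Ioo_mem_nhdsLT h1] with s hs using em s hs.1
  · intro t ht
    rw [ew t ht.2.le]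
    rcases lt_or_ge t a with h1 | h1
    · rw [ek t h1.le]
      filter_upwards [h.transition t ⟨ht.1, h1⟩, Ioo_mem_nhdsGT h1] with s hs hs'
      rw [ek s hs'.2.le, hs]
    · have : nextMode δ u₀ j (k' t) (z (x (t - τ))) = m := by
        rcases h1.eq_or_lt with rfl | h2
        · rw [ek _ le_rfl, hm]
        · rw [em t h2]; exact hconst t ⟨h2, ht.2⟩
      rw [this]
      filter_upwards [self_mem_nhdsWithin] with s hs using em s (h1.trans_lt hs)
  · intro t ht
    rw [ew t ht.2.le]
    rcases lt_or_ge t a with h1 | h1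
    · rw [ek t h1.le, ex t h1.le]
      refine (h.ode t ⟨ht.1, h1⟩).congr_of_eventuallyEq ?_ (ex t h1.le)
      filter_upwards [nhdsWithin_le_nhds (Iio_mem_nhds h1)] with s hs using ex s (le_of_lt hs)
    · have : nextMode δ u₀ j (k' t) (z (x (t - τ))) = m := by
        rcases h1.eq_or_lt with rfl | h2
        · rw [ek _ le_rfl, hm]
        · rw [em t h2]; exact hconst t ⟨h2, ht.2⟩
      rw [this, ey t h1]
      exact (hyd t ⟨h1, ht.2⟩).congr (fun s hs => ey s (h1.trans hs)) (ey t h1)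
  · intro t ht
    rw [ew t ht.2]
    rcases le_or_gt t a with h1 | h1
    · rw [ek t h1]; exact h.inMode t ⟨ht.1, h1⟩
    · rw [em t h1]; exact hmode t ⟨h1.le, ht.2⟩

/-- The solutions are Lipschitz, uniformly. -/
lemma IsSolutionUpTo.norm_sub_le {B L : ℝ} (hfB : ∀ p, ‖f p‖ ≤ B) (hgB : ∀ p, ‖g p‖ ≤ B)
    (hτ : 0 < τ) (hδ : δ ∈ Ioo (0 : ℝ) 1) (hu : 0 < u₀)
    (hφ : ∀ s t, s ∈ Icc (-(2 * τ)) 0 → t ∈ Icc (-(2 * τ)) 0 → s ≤ t → ‖φ t - φ s‖ ≤ L * (t - s))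
    (hL : B + u₀ * B ≤ L)
    (h : IsSolutionUpTo f g z τ δ u₀ j φ a x k) {s t : ℝ} (hs : -(2 * τ) ≤ s) (hst : s ≤ t)
    (hta : t ≤ a) : ‖x t - x s‖ ≤ L * (t - s) := by
  have hpos : ∀ s t : ℝ, 0 ≤ s → s ≤ t → t ≤ a → ‖x t - x s‖ ≤ L * (t - s) := by
    intro s t hs hst hta
    refine norm_image_sub_le_of_norm_deriv_right_le_segment (b := a) (f' := fun t =>
      f (x t) + quantOut δ u₀ j (nextMode δ u₀ j (k t) (z (x (t - τ)))) (z (x (t - τ))) • g (x t))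
      (h.continuousOn.mono (Icc_subset_Icc (by linarith) le_rfl))
      (fun r hr => h.ode r ⟨hs.trans hr.1, hr.2⟩) (fun r _ => ?_) t ⟨hst, hta⟩
    refine (norm_add_le _ _).trans (le_trans (add_le_add (hfB _) ?_) hL)
    rw [norm_smul, Real.norm_eq_abs]
    exact mul_le_mul (abs_quantOut_le hδ hu _ _) (hgB _) (norm_nonneg _) hu.le
  have hneg : ∀ s t : ℝ, -(2 * τ) ≤ s → s ≤ t → t ≤ 0 → ‖x t - x s‖ ≤ L * (t - s) := by
    intro s t hs hst ht
    rw [h.history s ⟨hs, hst.trans ht⟩, h.history t ⟨hs.trans hst, ht⟩]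
    exact hφ s t ⟨hs, hst.trans ht⟩ ⟨hs.trans hst, ht⟩ hst
  rcases le_total t 0 with h1 | h1
  · exact hneg s t hs hst h1
  · rcases le_total 0 s with h2 | h2
    · exact hpos s t h2 hst hta
    · have e1 := hpos 0 t le_rfl h1 hta
      have e2 := hneg s 0 hs h2 le_rfl
      have e3 := norm_sub_le_norm_sub_add_norm_sub (x t) (x 0) (x s)
      linarith

/-- Solutions can be extended by a uniform time step. -/
lemma exists_uniform_step {K : NNReal} {B L : ℝ} (hf : LipschitzWith K f)
    (hg : LipschitzWith K g) (hzK : LipschitzWith K z) (hfB : ∀ p, ‖f p‖ ≤ B)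
    (hgB : ∀ p, ‖g p‖ ≤ B) (hzu : ∀ p, |z p| ≤ u₀ / (1 - δ)) (hτ : 0 < τ)
    (hδ : δ ∈ Ioo (0 : ℝ) 1) (hu : 0 < u₀)
    (hφ : ∀ s t, s ∈ Icc (-(2 * τ)) 0 → t ∈ Icc (-(2 * τ)) 0 → s ≤ t → ‖φ t - φ s‖ ≤ L * (t - s))
    (hL : B + u₀ * B ≤ L) :
    ∃ h > 0, ∀ a ≥ 0, (∃ x k, IsSolutionUpTo f g z τ δ u₀ j φ a x k) →
      ∃ x k, IsSolutionUpTo f g z τ δ u₀ j φ (a + h) x k := by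
  obtain ⟨γ, hγ0, hγ⟩ := exists_threshold_gap (j := j) hδ hu
  have hB : 0 ≤ B := (norm_nonneg _).trans (hfB 0)
  have hL0 : 0 ≤ L := le_trans (by positivity) hL
  -- During a time `h` the input moves by at most `γ`, so a genuine switch is not followed by a
  -- second one within this time. The `+ 1` covers `K L = 0`.
  set h := min τ (γ / (K * L + 1)) with hh
  have hpos : 0 < h := lt_min hτ (by positivity)
  have hhγ : K * L * h ≤ γ := by
    have h1 : h ≤ γ / (K * L + 1) := min_le_right _ _
    rw [le_div_iff₀ (by positivity)] at h1
    nlinarith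
  refine ⟨h, hpos, fun a ha ⟨x, k, hx⟩ => ?_⟩
  have hhτ : h ≤ τ := min_le_left _ _
  have hzc := hzK.continuous
  set w : ℝ → ℝ := fun t => z (x (t - τ)) with hwdef
  have hw : ContinuousOn (fun t => |w t|) (Icc a (a + h)) :=
    (hzc.comp_continuousOn (hx.continuousOn.comp (by fun_prop)
      fun t ht => ⟨by linarith [ht.1], by linarith [ht.2]⟩)).abs
  have hwl : ∀ s t, a ≤ s → s ≤ t → t ≤ a + h → |w t - w s| ≤ γ := by
    intro s t hs hst ht
    have h1 := hzK.dist_le_mul (x (t - τ)) (x (s - τ))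
    rw [Real.dist_eq, dist_eq_norm] at h1
    have h2 := hx.norm_sub_le hfB hgB hτ hδ hu hφ hL (s := s - τ) (t := t - τ) (by linarith)
      (by linarith) (by linarith)
    have h3 : L * (t - τ - (s - τ)) ≤ L * h := mul_le_mul_of_nonneg_left (by linarith) hL0
    calc |w t - w s| ≤ K * ‖x (t - τ) - x (s - τ)‖ := h1
      _ ≤ K * (L * h) := mul_le_mul_of_nonneg_left (h2.trans h3) K.2
      _ ≤ γ := by rw [← mul_assoc]; exact hhγ
  have hin := hx.inMode a ⟨ha, le_rfl⟩
  set m := nextMode δ u₀ j (k a) (w a) with hm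
  obtain ⟨hm2, hlo, hup⟩ := hin.nextMode_strict hδ hu
  -- If the input leaves the open band of mode `m` before `a + h`, the least element of `S` is the
  -- only switch inside the step; otherwise no switch occurs there.
  set S : Set ℝ := {t | t ∈ Icc a (a + h) ∧
    (|w t| ≤ lowerThreshold δ u₀ j m ∨ upperThreshold δ u₀ j m ≤ |w t|)} with hS
  have hstrict : ∀ t ∈ Icc a (a + h), t ∉ S →
      lowerThreshold δ u₀ j m < |w t| ∧ |w t| < upperThreshold δ u₀ j m := fun t ht htS => by
    by_contra hc
    refine htS ⟨ht, ?_⟩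
    by_contra! hc'
    exact hc hc'
  rcases S.eq_empty_or_nonempty with hSe | hSne
  · have hs : ∀ t ∈ Icc a (a + h), lowerThreshold δ u₀ j m < |w t| ∧
        |w t| < upperThreshold δ u₀ j m := fun t ht => hstrict t ht (by rw [hSe]; simp)
    obtain ⟨x', k', hx', -⟩ := hx.extend (b := a + h) hf hg hfB hgB hzc hτ hδ hu ha (by linarith)
      (by linarith) hm.symm
      (fun t ht => nextMode_of_strict hm2 (hzu _) (hs t (Ioo_subset_Icc_self ht)).1
        (hs t (Ioo_subset_Icc_self ht)).2)
      (fun t ht => ⟨hzu _, hm2, (hs t ht).1.le, (hs t ht).2.le⟩)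
    exact ⟨x', k', hx'⟩
  · have hSc : IsCompact S := by
      have e : S = (Icc a (a + h) ∩ (fun t => |w t|) ⁻¹'
          (Iic (lowerThreshold δ u₀ j m) ∪ Ici (upperThreshold δ u₀ j m))) := by
        ext t; simp [hS]
      rw [e]
      exact isCompact_Icc.of_isClosed_subset
        (hw.preimage_isClosed_of_isClosed isClosed_Icc (isClosed_Iic.union isClosed_Ici))
        inter_subset_left
    obtain ⟨t₁, ht₁, hleast⟩ := hSc.exists_isLeast hSne
    have hat : a < t₁ := by
      refine lt_of_le_of_ne ht₁.1.1 ?_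
      rintro rfl
      rcases ht₁.2 with h1 | h1
      · exact absurd hlo (not_lt.2 h1)
      · exact absurd hup (not_lt.2 h1)
    have hs : ∀ t ∈ Ico a t₁, lowerThreshold δ u₀ j m < |w t| ∧
        |w t| < upperThreshold δ u₀ j m := fun t ht =>
      hstrict t ⟨ht.1, ht.2.le.trans ht₁.1.2⟩ fun hc => absurd (hleast hc) (not_le.2 ht.2)
    have hlim : Tendsto (fun t => |w t|) (𝓝[<] t₁) (𝓝 |w t₁|) := by
      refine (hw t₁ ht₁.1).mono_left (nhdsWithin_le_of_mem ?_)
      filter_upwards [Ico_mem_nhdsLT hat] with s hs' using ⟨hs'.1, hs'.2.le.trans ht₁.1.2⟩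
    have hlo₁ : lowerThreshold δ u₀ j m ≤ |w t₁| := by
      refine ge_of_tendsto hlim ?_
      filter_upwards [Ico_mem_nhdsLT hat] with s hs' using (hs s hs').1.le
    have hup₁ : |w t₁| ≤ upperThreshold δ u₀ j m := by
      refine le_of_tendsto hlim ?_
      filter_upwards [Ico_mem_nhdsLT hat] with s hs' using (hs s hs').2.le
    have hin₁ : InMode δ u₀ j m (w t₁) := ⟨hzu _, hm2, hlo₁, hup₁⟩
    have hsw : nextMode δ u₀ j m (w t₁) ≠ m := by
      intro hc
      obtain ⟨-, h1, h2⟩ := hin₁.nextMode_strict hδ hu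
      rw [hc] at h1 h2
      rcases ht₁.2 with h3 | h3 <;> linarith
    obtain ⟨x', k', hx', hxx', hk'⟩ := hx.extend (b := t₁) hf hg hfB hgB hzc hτ hδ hu ha hat
      (by linarith [ht₁.1.2]) hm.symm
      (fun t ht => nextMode_of_strict hm2 (hzu _) (hs t (Ioo_subset_Ico_self ht)).1
        (hs t (Ioo_subset_Ico_self ht)).2)
      (fun t ht => by
        rcases ht.2.eq_or_lt with rfl | h1
        · exact hin₁
        · exact ⟨hzu _, hm2, (hs t ⟨ht.1, h1⟩).1.le, (hs t ⟨ht.1, h1⟩).2.le⟩)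
    rcases ht₁.1.2.eq_or_lt with h1 | h1
    · exact ⟨x', k', h1 ▸ hx'⟩
    · obtain ⟨g1, g2⟩ := hin₁.gap_of_switch hγ hsw
      have hm2' := (hin₁.nextMode hδ hu).le
      have ew : ∀ t ≤ a + h, z (x' (t - τ)) = w t := fun t ht => by
        rw [hxx' _ (by linarith)]
      have hs₁ : ∀ t ∈ Icc t₁ (a + h),
          lowerThreshold δ u₀ j (nextMode δ u₀ j m (w t₁)) < |w t| ∧
          |w t| < upperThreshold δ u₀ j (nextMode δ u₀ j m (w t₁)) := fun t ht => by
        have h2 := (abs_abs_sub_abs_le_abs_sub (w t) (w t₁)).trans (hwl t₁ t hat.le ht.1 ht.2)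
        rw [abs_le] at h2
        exact ⟨by linarith [h2.1], by linarith [h2.2]⟩
      obtain ⟨x'', k'', hx'', -⟩ := hx'.extend (b := a + h) hf hg hfB hgB hzc hτ hδ hu
        (ha.trans hat.le) h1 (by linarith) (m := nextMode δ u₀ j m (w t₁))
        (by rw [hk', ew t₁ h1.le])
        (fun t ht => by
          rw [ew t ht.2.le]
          exact nextMode_of_strict hm2' (hzu _) (hs₁ t (Ioo_subset_Icc_self ht)).1
            (hs₁ t (Ioo_subset_Icc_self ht)).2)
        (fun t ht => by
          rw [ew t ht.2]
          exact ⟨hzu _, hm2', (hs₁ t ht).1.le, (hs₁ t ht).2.le⟩)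
      exact ⟨x'', k'', hx''⟩

/-- Global existence of hysteretic solutions for bounded Lipschitz data. -/
theorem exists_global_hystereticSolution {K : NNReal} {B L : ℝ} (hf : LipschitzWith K f)
    (hg : LipschitzWith K g) (hzK : LipschitzWith K z) (hfB : ∀ p, ‖f p‖ ≤ B)
    (hgB : ∀ p, ‖g p‖ ≤ B) (hzu : ∀ p, |z p| ≤ u₀ / (1 - δ)) (hτ : 0 < τ)
    (hδ : δ ∈ Ioo (0 : ℝ) 1) (hu : 0 < u₀)
    (hφ : ∀ s t, s ∈ Icc (-(2 * τ)) 0 → t ∈ Icc (-(2 * τ)) 0 → s ≤ t → ‖φ t - φ s‖ ≤ L * (t - s)) :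
    ∃ x k, IsHystereticSolution f g z τ δ u₀ j φ ⊤ x k ∧
      ∀ t, 0 ≤ t → InMode δ u₀ j (k t) (z (x (t - τ))) := by
  have hφ' : ∀ s t, s ∈ Icc (-(2 * τ)) 0 → t ∈ Icc (-(2 * τ)) 0 → s ≤ t →
      ‖φ t - φ s‖ ≤ max L (B + u₀ * B) * (t - s) := fun s t hs ht hst =>
    (hφ s t hs ht hst).trans (mul_le_mul_of_nonneg_right (le_max_left _ _) (sub_nonneg.2 hst))
  obtain ⟨h, hpos, hstep⟩ := exists_uniform_step (j := j) hf hg hzK hfB hgB hzu hτ hδ hu hφ'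
    (le_max_right _ _)
  have hall : ∀ N : ℕ, ∃ x k, IsSolutionUpTo f g z τ δ u₀ j φ (N * h) x k := by
    intro N
    induction N with
    | zero =>
      obtain ⟨m, hm⟩ := exists_initialMode (j := j) hδ (hzu (φ (0 - τ)))
      refine ⟨φ, fun _ => m, ⟨fun t _ => rfl, ?_, hm, ?_, ?_, ?_, ?_⟩⟩
      · have hc : LipschitzOnWith (max L (B + u₀ * B)).toNNReal φ (Icc (-(2 * τ)) 0) := by
          have key : ∀ s ∈ Icc (-(2 * τ)) 0, ∀ t ∈ Icc (-(2 * τ)) 0, s ≤ t →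
              dist (φ s) (φ t) ≤ (max L (B + u₀ * B)).toNNReal * dist s t := by
            intro s hs t ht hst
            rw [dist_comm, dist_eq_norm, dist_comm, Real.dist_eq, abs_of_nonneg (sub_nonneg.2 hst)]
            exact (hφ' s t hs ht hst).trans
              (mul_le_mul_of_nonneg_right (Real.le_coe_toNNReal _) (sub_nonneg.2 hst))
          refine LipschitzOnWith.of_dist_le_mul fun s hs t ht => ?_
          rcases le_total s t with h1 | h1
          · exact key s hs t ht h1
          · rw [dist_comm, dist_comm s]; exact key t ht s hs h1
        simpa using hc.continuousOn
      · intro t ht; simp at ht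
      · intro t ht; simp at ht
      · intro t ht; simp at ht
      · intro t ht
        simp only [Nat.cast_zero, zero_mul, Icc_self, mem_singleton_iff] at ht
        rw [ht]
        exact hm.inMode (hzu _)
    | succ N ih =>
      have := hstep (N * h) (by positivity) ih
      rwa [← add_one_mul, ← Nat.cast_succ] at this
  choose X Km hX using hall
  -- The `+ 1` makes `t < N(t) h` strict: uniqueness, which glues the pieces, compares solutions
  -- strictly before their final time.
  set N : ℝ → ℕ := fun t => ⌈t / h⌉₊ + 1 with hN
  have hNt : ∀ t, t < N t * h := fun t => by
    have h1 := Nat.le_ceil (t / h)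
    rw [div_le_iff₀ hpos] at h1
    simp only [hN, Nat.cast_add, Nat.cast_one]
    linarith
  have hXX : ∀ (M : ℕ) (t : ℝ), -(2 * τ) ≤ t → t < M * h → X (N t) t = X M t := by
    intro M t ht htM
    rcases le_total t 0 with h1 | h1
    · rw [(hX _).history t ⟨ht, h1⟩, (hX _).history t ⟨ht, h1⟩]
    · exact ((hX (N t)).isHystereticSolution.eq_of_lt hf.locallyLipschitz hg.locallyLipschitz
        hτ hδ hu (hX M).isHystereticSolution h1 (by exact_mod_cast hNt t)
        (by exact_mod_cast htM)).1
  have hKK : ∀ (M : ℕ) (t : ℝ), 0 ≤ t → t < M * h → Km (N t) t = Km M t := by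
    intro M t h1 htM
    exact ((hX (N t)).isHystereticSolution.eq_of_lt hf.locallyLipschitz hg.locallyLipschitz
        hτ hδ hu (hX M).isHystereticSolution h1 (by exact_mod_cast hNt t)
        (by exact_mod_cast htM)).2
  have hw : ∀ t : ℝ, 0 ≤ t → X (N (t - τ)) (t - τ) = X (N t) (t - τ) := fun t ht =>
    hXX (N t) (t - τ) (by linarith) (by linarith [hNt t])
  refine ⟨fun t => X (N t) t, fun t => Km (N t) t, ⟨?_, ?_, ?_, ?_, ?_, ?_, ?_⟩, ?_⟩
  · exact fun t ht => (hX _).history t ht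
  · intro t ht
    have h1 : ContinuousWithinAt (X (N t)) {t : ℝ | -(2 * τ) ≤ t ∧ (t : EReal) < ⊤} t := by
      refine ((hX (N t)).continuousOn t ⟨ht.1, (hNt t).le⟩).mono_of_mem_nhdsWithin ?_
      filter_upwards [self_mem_nhdsWithin, nhdsWithin_le_nhds (Iio_mem_nhds (hNt t))] with s h1 h2
      exact ⟨h1.1, le_of_lt h2⟩
    refine h1.congr_of_eventuallyEq ?_ rfl
    filter_upwards [self_mem_nhdsWithin, nhdsWithin_le_nhds (Iio_mem_nhds (hNt t))] with s h1 h2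
    exact hXX _ s h1.1 h2
  · exact fun t _ _ => hzu _
  · simp only [hw 0 le_rfl]
    exact (hX _).initial
  · intro t ht _
    filter_upwards [(hX (N t)).left_const t ⟨ht, (hNt t).le⟩, Ioo_mem_nhdsLT ht] with s h1 h2
    rw [hKK (N t) s h2.1.le (h2.2.trans (hNt t)), h1]
  · intro t ht _
    simp only [hw t ht]
    filter_upwards [(hX (N t)).transition t ⟨ht, hNt t⟩, Ioo_mem_nhdsGT (hNt t)] with s h1 h2
    rw [hKK (N t) s (ht.trans h2.1.le) h2.2, h1]
  · intro t ht _
    simp only [hw t ht]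
    refine ((hX (N t)).ode t ⟨ht, hNt t⟩).congr_of_eventuallyEq ?_ rfl
    filter_upwards [self_mem_nhdsWithin, nhdsWithin_le_nhds (Iio_mem_nhds (hNt t))] with s h1 h2
    have h1' : t ≤ s := h1
    exact hXX _ s (by linarith) h2
  · intro t ht
    simp only [hw t ht]
    exact (hX (N t)).inMode t ⟨ht, (hNt t).le⟩

end

/-! ### Truncation of the data to a ball. -/

noncomputable section

/-- Radial retraction onto the closed ball of radius `M`. -/
def radialRetraction {E : Type*} [NormedAddCommGroup E] [NormedSpace ℝ E] (M : ℝ) (p : E) : E :=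
  (M / max M ‖p‖) • p

section Retraction

variable {E : Type*} [NormedAddCommGroup E] [NormedSpace ℝ E] {M : ℝ}

lemma radialRetraction_of_norm_le (hM : 0 < M) {p : E} (hp : ‖p‖ ≤ M) :
    radialRetraction M p = p := by
  rw [radialRetraction, max_eq_left hp, div_self hM.ne', one_smul]

lemma norm_radialRetraction_le (hM : 0 < M) (p : E) : ‖radialRetraction M p‖ ≤ M := by
  have h : 0 < max M ‖p‖ := lt_max_of_lt_left hM
  rw [radialRetraction, norm_smul, Real.norm_eq_abs, abs_of_pos (by positivity),
    div_mul_eq_mul_div, div_le_iff₀ h]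
  exact mul_le_mul_of_nonneg_left (le_max_right _ _) hM.le

/-- Moving the point with the scaling factor fixed costs at most `‖p - q‖`, and so does changing the
factor at `q`. The argument works in any norm, hence the constant `2`. -/
lemma lipschitzWith_radialRetraction (hM : 0 < M) :
    LipschitzWith 2 (radialRetraction M : E → E) := by
  refine LipschitzWith.of_dist_le_mul fun p q => ?_
  have hp : 0 < max M ‖p‖ := lt_max_of_lt_left hM
  have hq : 0 < max M ‖q‖ := lt_max_of_lt_left hM
  have e : radialRetraction M p - radialRetraction M q =
      (M / max M ‖p‖) • (p - q) + (M / max M ‖p‖ - M / max M ‖q‖) • q := by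
    simp only [radialRetraction, smul_sub, sub_smul]; abel
  rw [dist_eq_norm, dist_eq_norm, e]
  have h1 : ‖(M / max M ‖p‖) • (p - q)‖ ≤ ‖p - q‖ := by
    rw [norm_smul, Real.norm_eq_abs, abs_of_pos (by positivity)]
    exact mul_le_of_le_one_left (norm_nonneg _) ((div_le_one hp).2 (le_max_left _ _))
  have h2 : ‖(M / max M ‖p‖ - M / max M ‖q‖) • q‖ ≤ ‖p - q‖ := by
    have h3 : M / max M ‖p‖ - M / max M ‖q‖ =
        M / max M ‖p‖ * ((max M ‖q‖ - max M ‖p‖) / max M ‖q‖) := by field_simp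
    have h4 : |max M ‖q‖ - max M ‖p‖| ≤ ‖p - q‖ := by
      rw [max_comm M, max_comm M]
      exact (abs_max_sub_max_le_abs _ _ _).trans
        ((abs_norm_sub_norm_le q p).trans (norm_sub_rev q p).le)
    rw [h3, norm_smul, Real.norm_eq_abs, abs_mul, abs_div (max M ‖q‖ - max M ‖p‖), abs_of_pos hq,
      abs_of_pos (by positivity : 0 < M / max M ‖p‖), mul_assoc,
      div_mul_eq_mul_div |max M ‖q‖ - max M ‖p‖|]
    have h5 : |max M ‖q‖ - max M ‖p‖| * ‖q‖ / max M ‖q‖ ≤ ‖p - q‖ := by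
      rw [div_le_iff₀ hq]
      exact mul_le_mul h4 (le_max_right _ _) (norm_nonneg _) (norm_nonneg _)
    exact (mul_le_of_le_one_left (by positivity) ((div_le_one hp).2 (le_max_left _ _))).trans h5
  refine (norm_add_le _ _).trans ?_
  push_cast; linarith

/-- Composition with the retraction makes a locally Lipschitz map globally Lipschitz. -/
lemma LocallyLipschitz.exists_lipschitzWith_comp_radialRetraction [ProperSpace E] {F : Type*}
    [PseudoMetricSpace F] {h : E → F} (hh : LocallyLipschitz h) (hM : 0 < M) :
    ∃ K, LipschitzWith K (h ∘ radialRetraction M) := by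
  obtain ⟨K, hK⟩ := hh.locallyLipschitzOn.exists_lipschitzOnWith_of_compact
    (isCompact_closedBall (0 : E) M)
  refine ⟨K * 2, ?_⟩
  have := hK.comp (lipschitzWith_radialRetraction (E := E) hM).lipschitzOnWith (s := univ)
    (fun p _ => by simpa using norm_radialRetraction_le hM p)
  exact lipschitzOnWith_univ.1 this

end Retraction

/-- A `C¹` function on a compact interval is Lipschitz. -/
lemma exists_lipschitz_bound_of_contDiffOn {E : Type*} [NormedAddCommGroup E] [NormedSpace ℝ E]
    {φ : ℝ → E} {a b : ℝ} (hab : a < b) (hφ : ContDiffOn ℝ 1 φ (Icc a b)) :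
    ∃ L, ∀ s t, s ∈ Icc a b → t ∈ Icc a b → s ≤ t → ‖φ t - φ s‖ ≤ L * (t - s) := by
  have hc := hφ.continuousOn_derivWithin (uniqueDiffOn_Icc hab) le_rfl
  obtain ⟨L, hL⟩ := isCompact_Icc.exists_bound_of_continuousOn hc
  refine ⟨L, fun s t hs ht hst => ?_⟩
  have := (convex_Icc a b).norm_image_sub_le_of_norm_derivWithin_le
    (hφ.differentiableOn one_ne_zero) hL hs ht
  rwa [Real.norm_eq_abs, abs_of_nonneg (sub_nonneg.2 hst)] at this

/-- A solution for the truncated data is a solution for the original data as long as it stays in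
the ball. -/
lemma IsHystereticSolution.of_radialRetraction {n : ℕ}
    {f g : EuclideanSpace ℝ (Fin n) → EuclideanSpace ℝ (Fin n)}
    {z : EuclideanSpace ℝ (Fin n) → ℝ} {τ δ u₀ M : ℝ} {j : ℕ}
    {φ : ℝ → EuclideanSpace ℝ (Fin n)} {x : ℝ → EuclideanSpace ℝ (Fin n)} {k : ℝ → ℕ}
    (hM : 0 < M) (hτ : 0 < τ)
    (h : IsHystereticSolution (f ∘ radialRetraction M) (g ∘ radialRetraction M)
      (z ∘ radialRetraction M) τ δ u₀ j φ ⊤ x k) {T : EReal} (hT : 0 < T)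
    (hx : ∀ t : ℝ, -(2 * τ) ≤ t → (t : EReal) < T → ‖x t‖ ≤ M) :
    IsHystereticSolution f g z τ δ u₀ j φ T x k := by
  have e : ∀ t : ℝ, -(2 * τ) ≤ t → (t : EReal) < T → radialRetraction M (x t) = x t :=
    fun t h0 ht => radialRetraction_of_norm_le hM (hx t h0 ht)
  have e' : ∀ t : ℝ, 0 ≤ t → (t : EReal) < T →
      radialRetraction M (x (t - τ)) = x (t - τ) := fun t h0 ht =>
    e _ (by linarith) ((EReal.coe_lt_coe_iff.2 (by linarith)).trans ht)
  refine ⟨h.history, h.continuousOn.mono fun t ht => ⟨ht.1, EReal.coe_lt_top t⟩, ?_, ?_, ?_, ?_, ?_⟩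
  · intro t h0 ht
    simpa [e' t h0 ht] using h.in_range t h0 (EReal.coe_lt_top t)
  · simpa only [Function.comp, e' 0 le_rfl hT] using h.initial
  · exact fun t h0 _ => h.left_const t h0 (EReal.coe_lt_top t)
  · intro t h0 ht
    simpa only [Function.comp, e' t h0 ht] using h.transition t h0 (EReal.coe_lt_top t)
  · intro t h0 ht
    simpa only [Function.comp, e' t h0 ht, e t (by linarith) ht] using
      h.ode t h0 (EReal.coe_lt_top t)

end

/-! ### Piecewise regularity of solutions. -/

noncomputable section

/-- Induction on the break points, cutting the interval at each interior one. Values at end points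
are irrelevant, as integrability is tested on the open interval. -/
lemma PiecewiseContOn.intervalIntegrable {h : ℝ → ℝ} {a b : ℝ} (hab : a ≤ b)
    (hh : PiecewiseContOn h a b) : IntervalIntegrable h MeasureTheory.volume a b := by
  obtain ⟨S, hS⟩ := hh
  induction S using Finset.induction_on generalizing a b with
  | empty =>
    rcases hab.eq_or_lt with rfl | hlt
    · simp
    · obtain ⟨k, hk, hhk⟩ := hS a b le_rfl hlt le_rfl (by simp)
      have hki : IntervalIntegrable k MeasureTheory.volume a b :=
        ContinuousOn.intervalIntegrable_of_Icc hab hk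
      rw [intervalIntegrable_iff_integrableOn_Ioo_of_le hab] at hki ⊢
      exact hki.congr_fun hhk.symm measurableSet_Ioo
  | insert s S _ ih =>
    by_cases hs : s ∈ Ioo a b
    · have h1 := ih hs.1.le (b := s) fun c d hc hcd hd hfree => hS c d hc hcd (hd.trans hs.2.le)
        fun r hr => by
          rcases Finset.mem_insert.1 hr with rfl | hr
          · exact fun h => absurd h.2 (not_lt.2 hd)
          · exact hfree r hr
      have h2 := ih hs.2.le (a := s) fun c d hc hcd hd hfree => hS c d (hs.1.le.trans hc) hcd hd
        fun r hr => by
          rcases Finset.mem_insert.1 hr with rfl | hr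
          · exact fun h => absurd h.1 (not_lt.2 hc)
          · exact hfree r hr
      exact h1.trans h2
    · refine ih hab fun c d hc hcd hd hfree => hS c d hc hcd hd fun r hr => ?_
      rcases Finset.mem_insert.1 hr with rfl | hr
      · exact fun h => hs ⟨hc.trans_lt h.1, h.2.trans_le hd⟩
      · exact hfree r hr

lemma PiecewiseContOn.comp_add_right {h : ℝ → ℝ} {a b a' b' r : ℝ} (hh : PiecewiseContOn h a b)
    (ha : a ≤ a' + r) (hb : b' + r ≤ b) : PiecewiseContOn (fun s => h (s + r)) a' b' := by
  obtain ⟨S, hS⟩ := hh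
  refine ⟨S.image (· - r), fun c d hc hcd hd hfree => ?_⟩
  obtain ⟨k, hk, hhk⟩ := hS (c + r) (d + r) (by linarith) (by linarith) (by linarith)
    fun s hs h => hfree (s - r) (Finset.mem_image_of_mem _ hs)
      ⟨by linarith [h.1], by linarith [h.2]⟩
  refine ⟨fun s => k (s + r), hk.comp (by fun_prop) fun s hs => ⟨?_, ?_⟩, fun s hs => ?_⟩
  · linarith [hs.1]
  · linarith [hs.2]
  · exact hhk ⟨by linarith [hs.1], by linarith [hs.2]⟩

lemma PiecewiseC1On.comp_add_right {E : Type*} [NormedAddCommGroup E] [NormedSpace ℝ E]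
    {h : ℝ → E} {a b a' b' r : ℝ} (hh : PiecewiseC1On h a b)
    (ha : a ≤ a' + r) (hb : b' + r ≤ b) : PiecewiseC1On (fun s => h (s + r)) a' b' := by
  obtain ⟨hc, S, hS⟩ := hh
  refine ⟨hc.comp (by fun_prop) fun s hs => ⟨?_, ?_⟩,
    S.image (· - r), fun c d hc hcd hd hfree => ?_⟩
  · linarith [hs.1]
  · linarith [hs.2]
  · refine (hS (c + r) (d + r) (by linarith) (by linarith) (by linarith)
      fun s hs h => hfree (s - r) (Finset.mem_image_of_mem _ hs)
        ⟨by linarith [h.1], by linarith [h.2]⟩).comp (by fun_prop) fun s hs => ⟨?_, ?_⟩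
    · linarith [hs.1]
    · linarith [hs.2]

/-- A continuous function with a continuous right derivative is `C¹`. -/
lemma contDiffOn_of_hasDerivWithinAt_right {E : Type*} [NormedAddCommGroup E] [NormedSpace ℝ E]
    [CompleteSpace E] {x G : ℝ → E} {c d : ℝ} (hcd : c < d) (hx : ContinuousOn x (Icc c d))
    (hG : ContinuousOn G (Icc c d)) (hd : ∀ t ∈ Ico c d, HasDerivWithinAt x (G t) (Ici t) t) :
    ContDiffOn ℝ 1 x (Icc c d) := by
  set G' : ℝ → E := IccExtend hcd.le (domRestrict (Icc c d) G) with hG'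
  have hGc : Continuous G' := (continuousOn_iff_continuous_domRestrict.1 hG).Icc_extend'
  have hGe : ∀ t ∈ Icc c d, G' t = G t := fun t ht => IccExtend_of_mem hcd.le _ ht
  -- This primitive is `C¹` and shares with `x` the right derivative and the value at `c`, so the
  -- two coincide on `[c, d]`.
  set y : ℝ → E := fun t => x c + ∫ s in c..t, G' s with hy
  have hyd : ∀ t, HasDerivAt y (G' t) t := fun t =>
    (hGc.integral_hasStrictDerivAt c t).hasDerivAt.const_add _
  have hy1 : ContDiff ℝ 1 y := by
    rw [contDiff_one_iff_deriv]
    refine ⟨fun t => (hyd t).differentiableAt, ?_⟩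
    rw [show deriv y = G' from funext fun t => (hyd t).deriv]
    exact hGc
  refine hy1.contDiffOn.congr fun t ht => ?_
  refine eq_of_has_deriv_right_eq hd (fun s hs => ?_) hx hy1.continuous.continuousOn ?_ t ht
  · rw [← hGe s (Ico_subset_Icc_self hs)]
    exact (hyd s).hasDerivWithinAt
  · simp [hy]

variable {n : ℕ} {f g : EuclideanSpace ℝ (Fin n) → EuclideanSpace ℝ (Fin n)}
  {z : EuclideanSpace ℝ (Fin n) → ℝ} {τ δ u₀ : ℝ} {j : ℕ}
  {φ : ℝ → EuclideanSpace ℝ (Fin n)} {T : EReal} {x : ℝ → EuclideanSpace ℝ (Fin n)} {k : ℝ → ℕ}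

/-- Index of the quantizer immediately after time `t`. -/
def modeAfter (z : EuclideanSpace ℝ (Fin n) → ℝ) (τ δ u₀ : ℝ) (j : ℕ)
    (x : ℝ → EuclideanSpace ℝ (Fin n)) (k : ℝ → ℕ) (t : ℝ) : ℕ :=
  nextMode δ u₀ j (k t) (z (x (t - τ)))

/-- Quantizer output immediately after time `t`. -/
def outAfter (z : EuclideanSpace ℝ (Fin n) → ℝ) (τ δ u₀ : ℝ) (j : ℕ)
    (x : ℝ → EuclideanSpace ℝ (Fin n)) (k : ℝ → ℕ) (t : ℝ) : ℝ :=
  quantOut δ u₀ j (modeAfter z τ δ u₀ j x k t) (z (x (t - τ)))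

/-- Quantizer gain immediately after time `t`. -/
def gainAfter (z : EuclideanSpace ℝ (Fin n) → ℝ) (τ δ u₀ : ℝ) (j : ℕ)
    (x : ℝ → EuclideanSpace ℝ (Fin n)) (k : ℝ → ℕ) (t : ℝ) : ℝ :=
  quantGain δ u₀ j (modeAfter z τ δ u₀ j x k t) (z (x (t - τ)))

lemma IsHystereticSolution.hasDerivWithinAt (h : IsHystereticSolution f g z τ δ u₀ j φ T x k)
    {t : ℝ} (h0 : 0 ≤ t) (ht : (t : EReal) < T) :
    HasDerivWithinAt x (f (x t) + outAfter z τ δ u₀ j x k t • g (x t)) (Ici t) t :=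
  h.ode t h0 ht

/-- On compact time intervals there are finitely many switches. -/
lemma IsHystereticSolution.exists_finset_modeAfter_eq
    (h : IsHystereticSolution f g z τ δ u₀ j φ T x k) (hδ : δ ∈ Ioo (0 : ℝ) 1) (hu : 0 < u₀)
    (hmode : ∀ t : ℝ, 0 ≤ t → (t : EReal) < T → InMode δ u₀ j (k t) (z (x (t - τ))))
    {b : ℝ} (hb : (b : EReal) < T) :
    ∃ S : Finset ℝ, ∀ c d : ℝ, 0 ≤ c → c < d → d ≤ b → (∀ s ∈ S, s ∉ Ioo c d) →
      ∃ m, (∀ t ∈ Ico c d, modeAfter z τ δ u₀ j x k t = m) ∧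
        ∀ t ∈ Icc c d, InMode δ u₀ j m (z (x (t - τ))) := by
  have hT : ∀ t ≤ b, (t : EReal) < T := fun t ht => (EReal.coe_le_coe_iff.2 ht).trans_lt hb
  -- The index is constant immediately on either side of each time. The centres of a finite subcover
  -- contain all switches in the interior, since `k` is locally constant elsewhere.
  have hloc : ∀ s : ℝ, ∃ U : Set ℝ, s ∈ Icc 0 b → IsOpen U ∧ s ∈ U ∧
      (∀ r ∈ U, 0 ≤ r → r < s → k r = k s) ∧
      ∀ r ∈ U, s < r → k r = modeAfter z τ δ u₀ j x k s := by
    intro s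
    by_cases hs : s ∈ Icc 0 b
    · have h1 : ∀ᶠ r in 𝓝 s, 0 ≤ r → r < s → k r = k s := by
        rcases hs.1.eq_or_lt with rfl | h0
        · exact Eventually.of_forall fun r h1 h2 => absurd h1 (not_le.2 h2)
        · filter_upwards [eventually_nhdsWithin_iff.1 (h.left_const s h0 (hT s hs.2))]
            with r hr _ h2 using hr h2
      have h2 := eventually_nhdsWithin_iff.1 (h.transition s hs.1 (hT s hs.2))
      obtain ⟨U, hU, hUo, hsU⟩ := eventually_nhds_iff.1 (h1.and h2)
      exact ⟨U, fun _ => ⟨hUo, hsU, fun r hr => (hU r hr).1, fun r hr => (hU r hr).2⟩⟩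
    · exact ⟨∅, fun h => absurd h hs⟩
  choose U hU using hloc
  obtain ⟨S, hS, hcov⟩ := isCompact_Icc.elim_nhds_subcover U
    (fun s hs => (hU s hs).1.mem_nhds (hU s hs).2.1 : ∀ s ∈ Icc 0 b, U s ∈ 𝓝 s)
  refine ⟨S, fun c d hc hcd hd hfree => ?_⟩
  have hcont : ContinuousOn k (Ioo c d) := by
    intro t ht
    obtain ⟨s, hs, hts⟩ := mem_iUnion₂.1 (hcov ⟨hc.trans ht.1.le, ht.2.le.trans hd⟩)
    obtain ⟨hUo, -, hl, hr⟩ := hU s (hS s hs)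
    have hne : t ≠ s := fun h => hfree s hs (h ▸ ht)
    have hev : ∀ᶠ r in 𝓝 t, k r = k t := by
      rcases lt_or_gt_of_ne hne with h1 | h1
      · filter_upwards [hUo.mem_nhds hts, Ioo_mem_nhds ht.1 h1] with r hr1 hr2
        rw [hl r hr1 (hc.trans hr2.1.le) hr2.2, hl t hts (hc.trans ht.1.le) h1]
      · filter_upwards [hUo.mem_nhds hts, Ioi_mem_nhds h1] with r hr1 hr2
        rw [hr r hr1 hr2, hr t hts h1]
    exact (continuousAt_const.congr (hev.mono fun r hr => hr.symm)).continuousWithinAt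
  obtain ⟨e, he⟩ := exists_between hcd
  have hk : ∀ t ∈ Ioo c d, k t = k e := fun t ht =>
    isPreconnected_Ioo.constant hcont ht he
  have hkp : ∀ t ∈ Ico c d, modeAfter z τ δ u₀ j x k t = k e := fun t ht => by
    obtain ⟨r, hr1, hr2⟩ := ((h.transition t (hc.trans ht.1) (hT t (ht.2.le.trans hd))).and
      (Ioo_mem_nhdsGT ht.2)).exists
    rw [modeAfter, ← hr1]
    exact hk r ⟨ht.1.trans_lt hr2.1, hr2.2⟩
  refine ⟨k e, hkp, fun t ht => ?_⟩
  rcases ht.2.eq_or_lt with rfl | h1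
  · obtain ⟨r, hr1, hr2⟩ := ((h.left_const t (hc.trans_lt hcd) (hT t hd)).and
      (Ioo_mem_nhdsLT hcd)).exists
    rw [← hk r hr2, hr1]
    exact hmode t (hc.trans hcd.le) (hT t hd)
  · rw [← hkp t ⟨ht.1, h1⟩]
    exact (hmode t (hc.trans ht.1) (hT t (ht.2.trans hd))).nextMode hδ hu

lemma IsHystereticSolution.continuousOn_input (h : IsHystereticSolution f g z τ δ u₀ j φ T x k)
    (hτ : 0 < τ) (hz : Continuous z) {b : ℝ} (hb : (b : EReal) < T) :
    ContinuousOn (fun t => z (x (t - τ))) (Icc 0 b) :=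
  hz.comp_continuousOn (h.continuousOn.comp (by fun_prop) fun t ht =>
    ⟨by linarith [ht.1], (EReal.coe_lt_coe_iff.2 (by linarith [ht.2])).trans hb⟩)

/-- The solution, the quantizer output and the quantizer gain are piecewise regular. -/
lemma IsHystereticSolution.piecewise_regular
    (h : IsHystereticSolution f g z τ δ u₀ j φ T x k) (hf : Continuous f) (hg : Continuous g)
    (hz : Continuous z) (hτ : 0 < τ) (hδ : δ ∈ Ioo (0 : ℝ) 1) (hu : 0 < u₀)
    (hφ : ContDiffOn ℝ 1 φ (Icc (-(2 * τ)) 0))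
    (hmode : ∀ t : ℝ, 0 ≤ t → (t : EReal) < T → InMode δ u₀ j (k t) (z (x (t - τ))))
    {b : ℝ} (hb : (b : EReal) < T) :
    PiecewiseC1On x (-(2 * τ)) b ∧ PiecewiseContOn (outAfter z τ δ u₀ j x k) 0 b ∧
      PiecewiseContOn (gainAfter z τ δ u₀ j x k) 0 b := by
  have hT : ∀ t ≤ b, (t : EReal) < T := fun t ht => (EReal.coe_le_coe_iff.2 ht).trans_lt hb
  obtain ⟨S, hS⟩ := h.exists_finset_modeAfter_eq hδ hu hmode hb
  have hw := h.continuousOn_input hτ hz hb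
  have hxc : ContinuousOn x (Icc (-(2 * τ)) b) :=
    h.continuousOn.mono fun t ht => ⟨ht.1, hT t ht.2⟩
  -- The time `0` is added as a break point: the derivative of `φ` there need not satisfy the
  -- equation.
  refine ⟨⟨hxc, insert 0 S, fun c d hc hcd hd hfree => ?_⟩,
    ⟨S, fun c d hc hcd hd hfree => ?_⟩, ⟨S, fun c d hc hcd hd hfree => ?_⟩⟩
  · rcases le_or_gt d 0 with hd0 | hd0
    · exact (hφ.mono (Icc_subset_Icc hc hd0)).congr fun t ht =>
        h.history t ⟨hc.trans ht.1, ht.2.trans hd0⟩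
    · have hc0 : 0 ≤ c := by
        by_contra! hneg
        exact hfree 0 (Finset.mem_insert_self _ _) ⟨hneg, hd0⟩
      obtain ⟨m, hm, hmi⟩ := hS c d hc0 hcd hd
        fun s hs => hfree s (Finset.mem_insert_of_mem hs)
      have hx := hxc.mono (Icc_subset_Icc hc hd)
      refine contDiffOn_of_hasDerivWithinAt_right hcd hx
        (G := fun t => f (x t) + quantOut δ u₀ j m (z (x (t - τ))) • g (x t))
        ((hf.comp_continuousOn hx).add ((continuousOn_quantOut hδ hu
          (hw.mono (Icc_subset_Icc hc0 hd)) hmi).smul (hg.comp_continuousOn hx))) fun t ht => ?_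
      have := h.hasDerivWithinAt (hc0.trans ht.1) (hT t (ht.2.le.trans hd))
      rwa [outAfter, hm t ht] at this
  · obtain ⟨m, hm, hmi⟩ := hS c d hc hcd hd hfree
    exact ⟨_, continuousOn_quantOut hδ hu (hw.mono (Icc_subset_Icc hc hd)) hmi,
      fun t ht => by rw [outAfter, hm t (Ioo_subset_Ico_self ht)]⟩
  · obtain ⟨m, hm, hmi⟩ := hS c d hc hcd hd hfree
    exact ⟨_, continuousOn_quantGain hδ hu (hw.mono (Icc_subset_Icc hc hd)) hmi,
      fun t ht => by rw [gainAfter, hm t (Ioo_subset_Ico_self ht)]⟩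

end

/-! ### Estimates of `V` along solutions and the Krasovskii memory term. -/

noncomputable section

variable {n : ℕ} {f g : EuclideanSpace ℝ (Fin n) → EuclideanSpace ℝ (Fin n)}
  {V W z : EuclideanSpace ℝ (Fin n) → ℝ} {κ₁ κ₂ κ₃ : ℝ → ℝ} {τ δ u₀ Ω : ℝ} {j : ℕ}
  {φ : ℝ → EuclideanSpace ℝ (Fin n)} {T : EReal} {x : ℝ → EuclideanSpace ℝ (Fin n)} {k : ℝ → ℕ}

lemma fderiv_apply_add_smul {E : Type*} [NormedAddCommGroup E] [NormedSpace ℝ E]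
    (L : E →L[ℝ] ℝ) (a b : E) (r : ℝ) : L (a + r • b) = L a + r * L b := by
  rw [map_add, map_smul, smul_eq_mul]

/-- Growth estimate along solutions, with no smallness assumption on the delayed state. -/
lemma RobustCLF.growth (hA : RobustCLF f g δ V W z κ₁ κ₂) (hA3 : GrowthRobust g V W z κ₃)
    (hδ : δ ∈ Ioo (0 : ℝ) 1) (hu : 0 < u₀) (hW : ∀ p, 0 ≤ W p) {m : ℕ}
    {p q : EuclideanSpace ℝ (Fin n)} {R : ℝ} (hq : ‖q‖ ≤ R)
    (hm : InMode δ u₀ j m (z q)) :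
    fderiv ℝ V p (f p + quantOut δ u₀ j m (z q) • g p) ≤ κ₃ R * (V p + 1) := by
  have hR : 0 ≤ R := (norm_nonneg q).trans hq
  -- Outside the dead zone the delayed state and its gain serve. In the dead zone the output `0` is
  -- `z` at the origin, so `a = 0` is admissible in (A3).
  obtain ⟨a, l, ha, hl, he⟩ : ∃ a l, ‖a‖ ≤ R ∧ l ∈ Icc (-δ) δ ∧
      quantOut δ u₀ j m (z q) = (1 + l) * z a := by
    by_cases h : m ≤ 2 * j + 1
    · obtain ⟨h1, h2⟩ := hm.quantGain_mem hδ hu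
      exact ⟨q, quantGain δ u₀ j m (z q) - 1, hq, ⟨by linarith, by linarith⟩,
        by rw [hm.quantOut_eq hδ hu h]; ring⟩
    · exact ⟨0, 0, by simpa using hR, ⟨by linarith [hδ.1], hδ.1.le⟩,
        by rw [quantOut_dead h, hA.z_zero, mul_zero]⟩
  have h1 := hA.decrease p l hl
  have h2 := hA3.bound p R hR l ⟨by linarith [hl.1, hδ.2], by linarith [hl.2, hδ.2]⟩ a ha
  rw [he]
  rw [fderiv_apply_add_smul] at h1 ⊢
  rw [lieDer] at h2
  -- Adding (A1) and (A3) leaves `-W + W/2 ≤ 0` besides the growth term.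
  nlinarith [hW p]

/-- Derivative of a scalar `C¹` function along a solution. -/
lemma IsHystereticSolution.hasDerivWithinAt_comp {F : EuclideanSpace ℝ (Fin n) → ℝ}
    (h : IsHystereticSolution f g z τ δ u₀ j φ T x k) (hF : ContDiff ℝ 1 F)
    {t : ℝ} (h0 : 0 ≤ t) (ht : (t : EReal) < T) :
    HasDerivWithinAt (fun s => F (x s))
      (fderiv ℝ F (x t) (f (x t) + outAfter z τ δ u₀ j x k t • g (x t))) (Ici t) t :=
  ((hF.differentiable one_ne_zero).differentiableAt.hasFDerivAt).comp_hasDerivWithinAt t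
    (h.hasDerivWithinAt h0 ht)

lemma continuous_lieDer {X : EuclideanSpace ℝ (Fin n) → EuclideanSpace ℝ (Fin n)}
    {F : EuclideanSpace ℝ (Fin n) → ℝ} (hX : Continuous X) (hF : ContDiff ℝ 1 F) :
    Continuous (lieDer X F) :=
  (hF.continuous_fderiv one_ne_zero).clm_apply hX

/-- Decrease estimate along solutions after one delay. -/
lemma RobustCLF.decrease_along (hA : RobustCLF f g δ V W z κ₁ κ₂)
    (hA2 : DelayRobust f g τ δ Ω V W z) (hf : Continuous f) (hg : Continuous g)
    (hτ : 0 < τ) (hδ : δ ∈ Ioo (0 : ℝ) 1) (hu : 0 < u₀)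
    (hφ : ContDiffOn ℝ 1 φ (Icc (-(2 * τ)) 0))
    (h : IsHystereticSolution f g z τ δ u₀ j φ T x k)
    (hmode : ∀ t : ℝ, 0 ≤ t → (t : EReal) < T → InMode δ u₀ j (k t) (z (x (t - τ))))
    {t Bv Bz : ℝ} (hτt : τ ≤ t) (ht : (t : EReal) < T) (hBv : |lieDer g V (x t)| ≤ Bv)
    (hBz : ∀ s ∈ Icc (t - τ) t, |lieDer g z (x s)| ≤ Bz) :
    fderiv ℝ V (x t) (f (x t) + outAfter z τ δ u₀ j x k t • g (x t)) ≤
      -(3 / 4) * W (x t) + 1 / Ω * (∫ s in (t - 2 * τ)..t, W (x s)) +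
        Bv * (1 + 2 * τ * Bz) * mainLevel δ u₀ j := by
  have hT : ∀ s ≤ t, (s : EReal) < T := fun s hs => (EReal.coe_le_coe_iff.2 hs).trans_lt ht
  have hz := hA.z_contDiff.continuous
  have hBv0 := (abs_nonneg _).trans hBv
  have hBz0 := (abs_nonneg _).trans (hBz t ⟨by linarith, le_rfl⟩)
  set u := mainLevel δ u₀ j with hudef
  have hu_pos : 0 < u := mainLevel_pos hδ hu j
  obtain ⟨hreg, hout, hgain⟩ := h.piecewise_regular hf hg hz hτ hδ hu hφ hmode ht
  have hin : ∀ s ∈ Icc 0 t, InMode δ u₀ j (modeAfter z τ δ u₀ j x k s) (z (x (s - τ))) :=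
    fun s hs => (hmode s hs.1 (hT s hs.2)).nextMode hδ hu
  have hgm : ∀ s ∈ Icc 0 t, gainAfter z τ δ u₀ j x k s ∈ Icc (1 - δ) (1 + δ) := fun s hs =>
    (hin s hs).quantGain_mem hδ hu
  have hdef : ∀ s ∈ Icc 0 t, |outAfter z τ δ u₀ j x k s -
      gainAfter z τ δ u₀ j x k s * z (x (s - τ))| ≤ u := fun s hs =>
    (hin s hs).abs_quantOut_sub_le hδ hu
  set G := gainAfter z τ δ u₀ j x k with hG
  set O := outAfter z τ δ u₀ j x k with hO
  have hxc : ContinuousOn x (Icc 0 t) := hreg.1.mono (Icc_subset_Icc (by linarith) le_rfl)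
  have hwc := h.continuousOn_input hτ hz ht
  -- the derivative of the input and its approximation
  set D : ℝ → ℝ := fun s => lieDer f z (x s) + O s * lieDer g z (x s) with hD
  set H : ℝ → ℝ := fun s => delayH f g z (x s) (x (s - τ)) (G s) with hH
  have hsub : Icc (t - τ) t ⊆ Icc 0 t := Icc_subset_Icc (by linarith) le_rfl
  have hle : t - τ ≤ t := by linarith
  have hii : ∀ {q : ℝ → ℝ}, PiecewiseContOn q 0 t →
      IntervalIntegrable q MeasureTheory.volume (t - τ) t := fun hq =>
    (hq.intervalIntegrable (by linarith)).mono_set (by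
      rw [uIcc_of_le hle, uIcc_of_le (by linarith)]; exact hsub)
  have hlf : ContinuousOn (fun s => lieDer f z (x s)) (Icc (t - τ) t) :=
    (continuous_lieDer hf hA.z_contDiff).comp_continuousOn (hxc.mono hsub)
  have hlg : ContinuousOn (fun s => lieDer g z (x s)) (Icc (t - τ) t) :=
    (continuous_lieDer hg hA.z_contDiff).comp_continuousOn (hxc.mono hsub)
  have hDi : IntervalIntegrable D MeasureTheory.volume (t - τ) t :=
    (hlf.intervalIntegrable_of_Icc hle).add
      ((hii hout).mul_continuousOn (by rwa [uIcc_of_le hle]))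
  have hHi : IntervalIntegrable H MeasureTheory.volume (t - τ) t := by
    refine (hlf.intervalIntegrable_of_Icc hle).add ?_
    have h1 : IntervalIntegrable (fun s => lieDer g z (x s) * G s)
        MeasureTheory.volume (t - τ) t := (hii hgain).continuousOn_mul (by rwa [uIcc_of_le hle])
    exact h1.mul_continuousOn (by rw [uIcc_of_le hle]; exact hwc.mono hsub)
  have hID : ∫ s in (t - τ)..t, D s = z (x t) - z (x (t - τ)) := by
    refine intervalIntegral.integral_eq_sub_of_hasDeriv_right_of_le hle
      (hz.comp_continuousOn (hxc.mono hsub)) (fun s hs => ?_) hDi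
    have h1 := h.hasDerivWithinAt_comp hA.z_contDiff (by linarith [hs.1]) (hT s hs.2.le)
    rw [fderiv_apply_add_smul] at h1
    exact h1.mono Ioi_subset_Ici_self
  have hDH : |(∫ s in (t - τ)..t, D s) - ∫ s in (t - τ)..t, H s| ≤ Bz * u * τ := by
    rw [← intervalIntegral.integral_sub hDi hHi, ← Real.norm_eq_abs]
    have h1 := intervalIntegral.norm_integral_le_of_norm_le_const (a := t - τ) (b := t)
      (f := fun s => D s - H s) (C := Bz * u) fun s hs => ?_
    · rwa [sub_sub_cancel, abs_of_pos hτ] at h1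
    · rw [uIoc_of_le hle] at hs
      have hs' := Ioc_subset_Icc_self hs
      have e : D s - H s = lieDer g z (x s) * (O s - G s * z (x (s - τ))) := by
        simp only [hD, hH, delayH]; ring
      rw [e, Real.norm_eq_abs, abs_mul]
      exact mul_le_mul (hBz s hs') (hdef s (hsub hs')) (abs_nonneg _) hBz0
  -- the delay robustness inequality
  have hgt := hgm t ⟨by linarith, le_rfl⟩
  have hδ0 : δ ≠ 0 := hδ.1.ne'
  -- The choice of `l₁` makes `1 + l₁ δ` the gain at `t`, and the window `[0, 2τ]` is shifted to
  -- `[t-2τ, t]`. As `t ≥ τ`, the gain is evaluated at nonnegative times only.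
  have key := hA2 (x t) (fun l => x (l + (t - 2 * τ)))
    (hreg.comp_add_right (by linarith) (by linarith)) ((G t - 1) / δ)
    (by
      rw [mem_Icc, le_div_iff₀ hδ.1, div_le_iff₀ hδ.1]
      exact ⟨by linarith [hgt.1], by linarith [hgt.2]⟩)
    (fun l => G (l + (t - τ))) (hgain.comp_add_right (by linarith) (by linarith))
    (fun m hm => hgm _ ⟨by linarith [hm.1], by linarith [hm.2]⟩)
  have e1 : ∫ l in (0 : ℝ)..(2 * τ), W (x (l + (t - 2 * τ))) =
      ∫ s in (t - 2 * τ)..t, W (x s) := by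
    rw [intervalIntegral.integral_comp_add_right (fun s => W (x s))]
    congr 1 <;> ring
  have e2 : ∫ l in τ..(2 * τ), delayH f g z (x (l + (t - 2 * τ))) (x (l - τ + (t - 2 * τ)))
      (G (l - τ + (t - τ))) = ∫ s in (t - τ)..t, H s := by
    have e3 : ∀ l, delayH f g z (x (l + (t - 2 * τ))) (x (l - τ + (t - 2 * τ)))
      (G (l - τ + (t - τ))) = H (l + (t - 2 * τ)) := fun l => by
      simp only [hH]
      congr 2 <;> ring
    simp only [e3]
    rw [intervalIntegral.integral_comp_add_right H]
    congr 1 <;> ring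
  rw [delayT, e1, e2, div_mul_cancel₀ _ hδ0, add_sub_cancel] at key
  have hdec := hA.decrease (x t) (G t - 1) ⟨by linarith [hgt.1], by linarith [hgt.2]⟩
  rw [fderiv_apply_add_smul, add_sub_cancel] at hdec
  rw [fderiv_apply_add_smul]
  have hv : fderiv ℝ V (x t) (g (x t)) = lieDer g V (x t) := rfl
  rw [hv] at hdec ⊢
  set v := lieDer g V (x t) with hvdef
  set ID := ∫ s in (t - τ)..t, D s with hIDdef
  set IH := ∫ s in (t - τ)..t, H s with hIHdef
  set e := O t - G t * z (x (t - τ)) with he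
  have he' : |e| ≤ u := hdef t ⟨by linarith, le_rfl⟩
  have hzx : z (x (t - τ)) = z (x t) - ID := by rw [hID]; ring
  -- Undelayed feedback with gain `G`, for (A1); delay term, for (A2); and a remainder of order
  -- `u_j` coming from the dead zone, now and during the last delay interval.
  have hOt : O t = G t * z (x t) - G t * IH - G t * (ID - IH) + e := by
    rw [he, hzx]; ring
  have herr : v * (-(G t * (ID - IH)) + e) ≤ Bv * (1 + 2 * τ * Bz) * u := by
    have hG2 : |G t| ≤ 2 := by
      rw [abs_le]; constructor <;> linarith [hgt.1, hgt.2, hδ.2]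
    have h1 : |G t * (ID - IH)| ≤ 2 * (Bz * u * τ) := by
      rw [abs_mul]; exact mul_le_mul hG2 hDH (abs_nonneg _) (by norm_num)
    have h2 : |-(G t * (ID - IH)) + e| ≤ 2 * (Bz * u * τ) + u :=
      (abs_add_le _ _).trans (by rw [abs_neg]; exact add_le_add h1 he')
    calc v * (-(G t * (ID - IH)) + e) ≤ |v| * |-(G t * (ID - IH)) + e| := by
          rw [← abs_mul]; exact le_abs_self _
      _ ≤ Bv * (2 * (Bz * u * τ) + u) := mul_le_mul hBv h2 (abs_nonneg _) hBv0
      _ = Bv * (1 + 2 * τ * Bz) * u := by ring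
  rw [hOt]
  have e4 : (G t * z (x t) - G t * IH - G t * (ID - IH) + e) * v =
      G t * z (x t) * v - v * G t * IH + v * (-(G t * (ID - IH)) + e) := by ring
  rw [e4]
  linarith

/-- The delay part `∫_{t-2τ}^t ∫_l^t y(m) dm dl` of the Lyapunov-Krasovskii functional. -/
def delayMemory (τ : ℝ) (y : ℝ → ℝ) (t : ℝ) : ℝ :=
  2 * τ * (∫ m in (0 : ℝ)..t, y m) -
    ((∫ l in (0 : ℝ)..t, ∫ m in (0 : ℝ)..l, y m) -
      ∫ l in (0 : ℝ)..(t - 2 * τ), ∫ m in (0 : ℝ)..l, y m)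

/-- Written with primitives from `0`, the double integral is differentiated by the fundamental
theorem alone. The term `-∫_{t-2τ}^t y` is the one that will beat the delay integral in the decrease
estimate. -/
lemma hasDerivAt_delayMemory {y : ℝ → ℝ} (hy : Continuous y) (t : ℝ) :
    HasDerivAt (delayMemory τ y) (2 * τ * y t - ∫ m in (t - 2 * τ)..t, y m) t := by
  have h1 : ∀ s, HasDerivAt (fun t => ∫ m in (0 : ℝ)..t, y m) (y s) s := fun s =>
    hy.integral_hasStrictDerivAt 0 s |>.hasDerivAt
  have hc : Continuous fun t => ∫ m in (0 : ℝ)..t, y m :=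
    continuous_iff_continuousAt.2 fun s => (h1 s).continuousAt
  have h2 : ∀ s, HasDerivAt (fun t => ∫ l in (0 : ℝ)..t, ∫ m in (0 : ℝ)..l, y m)
      (∫ m in (0 : ℝ)..s, y m) s := fun s => hc.integral_hasStrictDerivAt 0 s |>.hasDerivAt
  have h3 := (h2 (t - 2 * τ)).comp_sub_const t (2 * τ)
  have e : ∫ m in (t - 2 * τ)..t, y m =
      (∫ m in (0 : ℝ)..t, y m) - ∫ m in (0 : ℝ)..(t - 2 * τ), y m :=
    (intervalIntegral.integral_interval_sub_left (hy.intervalIntegrable _ _)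
      (hy.intervalIntegrable _ _)).symm
  rw [e]
  exact ((h1 t).const_mul _).sub ((h2 t).sub h3)

/-- With `Y` a primitive of `y`, the memory is the integral of `Y(t) - Y(l)` over `[t-2τ, t]`, and
`Y` is nondecreasing. -/
lemma delayMemory_mem {y : ℝ → ℝ} (hy : Continuous y) (hy0 : ∀ t, 0 ≤ y t) (hτ : 0 < τ) (t : ℝ) :
    0 ≤ delayMemory τ y t ∧ delayMemory τ y t ≤ 2 * τ * ∫ m in (t - 2 * τ)..t, y m := by
  have hc : Continuous fun t => ∫ m in (0 : ℝ)..t, y m :=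
    continuous_iff_continuousAt.2 fun s => (hy.integral_hasStrictDerivAt 0 s).hasDerivAt.continuousAt
  have hmono : ∀ s t : ℝ, s ≤ t → (∫ m in (0 : ℝ)..s, y m) ≤ ∫ m in (0 : ℝ)..t, y m := by
    intro s t hst
    rw [← sub_nonneg, intervalIntegral.integral_interval_sub_left (hy.intervalIntegrable _ _)
      (hy.intervalIntegrable _ _)]
    exact intervalIntegral.integral_nonneg hst fun u _ => hy0 u
  have e : ∫ m in (t - 2 * τ)..t, y m =
      (∫ m in (0 : ℝ)..t, y m) - ∫ m in (0 : ℝ)..(t - 2 * τ), y m :=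
    (intervalIntegral.integral_interval_sub_left (hy.intervalIntegrable _ _)
      (hy.intervalIntegrable _ _)).symm
  have hle : t - 2 * τ ≤ t := by linarith
  rw [delayMemory, e, intervalIntegral.integral_interval_sub_left (hc.intervalIntegrable _ _)
    (hc.intervalIntegrable _ _)]
  have hconst : ∀ c : ℝ, ∫ _ in (t - 2 * τ)..t, c = 2 * τ * c := fun c => by
    rw [intervalIntegral.integral_const, smul_eq_mul]; ring
  have h1 : ∫ l in (t - 2 * τ)..t, (∫ m in (0 : ℝ)..l, y m) ≤
      ∫ _ in (t - 2 * τ)..t, ∫ m in (0 : ℝ)..t, y m :=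
    intervalIntegral.integral_mono_on hle (hc.intervalIntegrable _ _)
      intervalIntegrable_const fun l hl => hmono l t hl.2
  have h2 : ∫ _ in (t - 2 * τ)..t, (∫ m in (0 : ℝ)..(t - 2 * τ), y m) ≤
      ∫ l in (t - 2 * τ)..t, ∫ m in (0 : ℝ)..l, y m :=
    intervalIntegral.integral_mono_on hle intervalIntegrable_const
      (hc.intervalIntegrable _ _) fun l hl => hmono _ l hl.1
  rw [hconst] at h1 h2
  constructor <;> linarith

/-- A function whose right derivative is at most `-ν` wherever it is at least `c` is either
below `c` or decays linearly. -/
lemma le_or_le_sub_of_deriv_right {u u' : ℝ → ℝ} {a b c ν : ℝ} (hν : 0 < ν)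
    (hu : ContinuousOn u (Icc a b)) (hd : ∀ t ∈ Ico a b, HasDerivWithinAt u (u' t) (Ici t) t)
    (hdec : ∀ t ∈ Ico a b, c ≤ u t → u' t ≤ -ν) {t : ℝ} (ht : t ∈ Icc a b) :
    u t ≤ c ∨ u t ≤ u a - ν * (t - a) := by
  by_cases hex : ∃ s ∈ Icc a t, u s ≤ c
  · obtain ⟨s, hs, hus⟩ := hex
    left
    -- Where `u = c` the right derivative is at most `-ν < 0`, so the level `c` is not crossed
    -- upwards.
    refine image_le_of_deriv_right_lt_deriv_boundary (a := s) (b := t) (B := fun _ => c)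
      (B' := fun _ => 0) (hu.mono (Icc_subset_Icc hs.1 ht.2))
      (fun r hr => hd r ⟨hs.1.trans hr.1, hr.2.trans_le ht.2⟩) hus
      (fun r => hasDerivAt_const r c) (fun r hr hrc => ?_) ⟨hs.2, le_rfl⟩
    have := hdec r ⟨hs.1.trans hr.1, hr.2.trans_le ht.2⟩ hrc.ge
    linarith
  · push Not at hex
    right
    have hB : ∀ r, HasDerivAt (fun r => u a - ν * (r - a)) (-ν) r := fun r => by
      simpa using (((hasDerivAt_id r).sub_const a).const_mul ν).const_sub (u a)
    refine image_le_of_deriv_right_le_deriv_boundary (a := a) (b := t)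
      (B := fun r => u a - ν * (r - a)) (B' := fun _ => -ν) (hu.mono (Icc_subset_Icc le_rfl ht.2))
      (fun r hr => hd r ⟨hr.1, hr.2.trans_le ht.2⟩) (by simp)
      (fun r _ => (hB r).continuousAt.continuousWithinAt)
      (fun r _ => (hB r).hasDerivWithinAt) (fun r hr => ?_) ⟨ht.1, le_rfl⟩
    exact hdec r ⟨hr.1, hr.2.trans_le ht.2⟩ (hex r ⟨hr.1, hr.2.le⟩).le

end

/-! ### Lyapunov-Krasovskii analysis and choice of the quantizer. -/

section

variable {n : ℕ} {f g : EuclideanSpace ℝ (Fin n) → EuclideanSpace ℝ (Fin n)}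
  {V W z : EuclideanSpace ℝ (Fin n) → ℝ} {κ₁ κ₂ κ₃ : ℝ → ℝ} {τ δ u₀ Ω : ℝ} {j : ℕ}
  {φ : ℝ → EuclideanSpace ℝ (Fin n)} {T : EReal} {x : ℝ → EuclideanSpace ℝ (Fin n)} {k : ℝ → ℕ}

lemma IsPosDefFun.nonneg {F : EuclideanSpace ℝ (Fin n) → ℝ} (hF : IsPosDefFun F)
    (p : EuclideanSpace ℝ (Fin n)) : 0 ≤ F p := by
  rcases eq_or_ne p 0 with rfl | hp
  · exact hF.1.ge
  · exact (hF.2 p hp).le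

/-- Bound on the Lyapunov function during the first delay interval. -/
lemma RobustCLF.bound_first_delay (hA : RobustCLF f g δ V W z κ₁ κ₂)
    (hA3 : GrowthRobust g V W z κ₃) (hτ : 0 < τ) (hδ : δ ∈ Ioo (0 : ℝ) 1) (hu : 0 < u₀)
    {R : ℝ} (hφR : ∀ t ∈ Icc (-(2 * τ)) 0, ‖φ t‖ ≤ R)
    (h : IsHystereticSolution f g z τ δ u₀ j φ T x k)
    (hmode : ∀ t : ℝ, 0 ≤ t → (t : EReal) < T → InMode δ u₀ j (k t) (z (x (t - τ))))
    {t : ℝ} (h0 : 0 ≤ t) (htτ : t ≤ τ) (ht : (t : EReal) < T) :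
    V (x t) + 1 ≤ (κ₂ R + 1) * Real.exp (κ₃ R * τ) := by
  have hT : ∀ s ≤ t, (s : EReal) < T := fun s hs => (EReal.coe_le_coe_iff.2 hs).trans_lt ht
  have h0m : (0 : ℝ) ∈ Icc (-(2 * τ)) 0 := ⟨by linarith, le_rfl⟩
  have hR : 0 ≤ R := (norm_nonneg _).trans (hφR 0 h0m)
  have hx0 : V (x 0) + 1 ≤ κ₂ R + 1 := by
    have h1 := hA.upper (x 0)
    have h2 : ‖x 0‖ ≤ R := by rw [h.history 0 h0m]; exact hφR 0 h0m
    have h3 := hA.κ₂_classK.strictMonoOn.monotoneOn (norm_nonneg (x 0)) hR h2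
    linarith
  -- (A3) at the origin. The sign is needed to replace `t` by `τ` in the exponent.
  have hκ3 : 0 ≤ κ₃ R := by
    have := hA3.bound 0 R hR 0 ⟨by norm_num, by norm_num⟩ 0 (by simpa using hR)
    rw [hA.W_posDef.1, hA.V_posDef.1] at this
    simpa using this
  have hc : ContinuousOn (fun s => V (x s) + 1) (Icc 0 t) :=
    (hA.V_contDiff.continuous.comp_continuousOn (h.continuousOn.mono fun s hs =>
      ⟨by linarith [hs.1], hT s hs.2⟩)).add continuousOn_const
  have key := le_gronwallBound_of_liminf_deriv_right_le (K := κ₃ R) (ε := 0) hc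
    (f' := fun s => fderiv ℝ V (x s) (f (x s) + outAfter z τ δ u₀ j x k s • g (x s)))
    (fun s hs r hr => ((h.hasDerivWithinAt_comp hA.V_contDiff hs.1 (hT s hs.2.le)).add_const
      1).liminf_right_slope_le hr) hx0 (fun s hs => by
      have hd : ‖x (s - τ)‖ ≤ R := by
        have : s - τ ∈ Icc (-(2 * τ)) 0 := ⟨by linarith [hs.1], by linarith [hs.2]⟩
        rw [h.history _ this]; exact hφR _ this
      have := hA.growth hA3 hδ hu hA.W_posDef.nonneg (p := x s) hd
        ((hmode s hs.1 (hT s hs.2.le)).nextMode hδ hu)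
      simpa [outAfter, modeAfter] using this) t ⟨h0, le_rfl⟩
  rw [gronwallBound_ε0, sub_zero] at key
  refine key.trans (mul_le_mul_of_nonneg_left (Real.exp_le_exp.2
    (mul_le_mul_of_nonneg_left htτ hκ3)) ?_)
  linarith [hA.V_posDef.nonneg (x 0)]

/-- Lyapunov-Krasovskii estimate: boundedness, and ultimate boundedness with a time bound. -/
lemma RobustCLF.lyapunov_estimate (hA : RobustCLF f g δ V W z κ₁ κ₂)
    (hA2 : DelayRobust f g τ δ Ω V W z) (hA3 : GrowthRobust g V W z κ₃)
    (hf : Continuous f) (hg : Continuous g) (hΩ : 16 * τ ≤ Ω)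
    (hτ : 0 < τ) (hδ : δ ∈ Ioo (0 : ℝ) 1) (hu : 0 < u₀)
    (hφ : ContDiffOn ℝ 1 φ (Icc (-(2 * τ)) 0))
    {R r E E' w c ν M Bv Bz : ℝ} (hφR : ∀ t ∈ Icc (-(2 * τ)) 0, ‖φ t‖ ≤ R)
    (h : IsHystereticSolution f g z τ δ u₀ j φ T x k)
    (hmode : ∀ t : ℝ, 0 ≤ t → (t : EReal) < T → InMode δ u₀ j (k t) (z (x (t - τ))))
    (hE : (κ₂ R + 1) * Real.exp (κ₃ R * τ) ≤ E) (hr : ∀ p, V p ≤ E → ‖p‖ ≤ r) (hRr : R ≤ r)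
    (hw : ∀ p, ‖p‖ ≤ r → W p ≤ w) (hE' : E + 2 / Ω * (2 * τ * (2 * τ * w)) ≤ E')
    (hM : ∀ t : ℝ, 0 ≤ t → (t : EReal) < T → ‖x t‖ ≤ M)
    (hBv : ∀ p, ‖p‖ ≤ M → |lieDer g V p| ≤ Bv) (hBz : ∀ p, ‖p‖ ≤ M → |lieDer g z p| ≤ Bz)
    (hc0 : 0 < c) (hcE : c ≤ E') (hν : 0 < ν)
    (hνW : ∀ p, ‖p‖ ≤ M → c / 2 ≤ V p → 4 * ν ≤ W p) (hνc : 2 * ν ≤ c / (8 * τ))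
    (hres : Bv * (1 + 2 * τ * Bz) * mainLevel δ u₀ j ≤ ν)
    {t : ℝ} (h0 : 0 ≤ t) (ht : (t : EReal) < T) :
    V (x t) ≤ E' ∧ (τ + E' / ν ≤ t → V (x t) ≤ c) := by
  have hT : ∀ s ≤ t, (s : EReal) < T := fun s hs => (EReal.coe_le_coe_iff.2 hs).trans_lt ht
  have hΩ0 : 0 < Ω := by linarith
  have hW0 := hA.W_posDef.nonneg
  have hV0 := hA.V_posDef.nonneg
  have hR : 0 ≤ R := (norm_nonneg _).trans (hφR 0 ⟨by linarith, le_rfl⟩)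
  have hw0 : 0 ≤ w := (hW0 0).trans (hw 0 (by simpa using hR.trans hRr))
  have hEE' : E ≤ E' := le_trans (le_add_of_nonneg_right (by positivity)) hE'
  have hE'0 : 0 < E' := hc0.trans_le hcE
  rcases lt_or_ge t τ with htτ | htτ
  · have h1 := hA.bound_first_delay hA3 hτ hδ hu hφR h hmode h0 htτ.le ht
    refine ⟨by linarith, fun h2 => ?_⟩
    have : 0 < E' / ν := div_pos hE'0 hν
    linarith
  have hxc : ContinuousOn x (Icc (-(2 * τ)) t) :=
    h.continuousOn.mono fun s hs => ⟨hs.1, hT s hs.2⟩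
  -- Clamping time to `[-2τ, t]` makes the integrand continuous on the whole line, without changing
  -- it on the windows in use.
  set pr : ℝ → ℝ := fun s => max (-(2 * τ)) (min s t) with hpr
  have hprm : ∀ s, pr s ∈ Icc (-(2 * τ)) t := fun s =>
    ⟨le_max_left _ _, max_le (by linarith) (min_le_right _ _)⟩
  have hpre : ∀ s ∈ Icc (-(2 * τ)) t, pr s = s := fun s hs => by
    simp only [hpr]; rw [min_eq_left hs.2, max_eq_right hs.1]
  set y : ℝ → ℝ := fun s => W (x (pr s)) with hy
  have hyc : Continuous y :=
    hA.W_continuous.comp (hxc.comp_continuous (by fun_prop) hprm)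
  have hye : ∀ s ∈ Icc (-(2 * τ)) t, y s = W (x s) := fun s hs => by
    simp only [hy]; rw [hpre s hs]
  have hyint : ∀ s ∈ Icc τ t, ∫ m in (s - 2 * τ)..s, y m = ∫ m in (s - 2 * τ)..s, W (x m) :=
    fun s hs => intervalIntegral.integral_congr fun m hm => by
      rw [uIcc_of_le (by linarith)] at hm
      exact hye m ⟨by linarith [hm.1, hs.1], hm.2.trans hs.2⟩
  have hmem := fun s => delayMemory_mem (τ := τ) hyc (fun s => hW0 _) hτ s
  -- The weight `2/Ω` turns `+(1/Ω)∫W` into `-(1/Ω)∫W`. It costs `(4τ/Ω) W ≤ W/4`, which is where `Ω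
  -- ≥ 16τ` enters.
  set U : ℝ → ℝ := fun s => V (x s) + 2 / Ω * delayMemory τ y s with hU
  have hVU : ∀ s, V (x s) ≤ U s := fun s =>
    le_add_of_nonneg_right (mul_nonneg (by positivity) (hmem s).1)
  have hUc : ContinuousOn U (Icc τ t) :=
    (hA.V_contDiff.continuous.comp_continuousOn
      (hxc.mono (Icc_subset_Icc (by linarith) le_rfl))).add
    (continuousOn_const.mul (continuous_iff_continuousAt.2 fun s =>
      (hasDerivAt_delayMemory hyc s).continuousAt).continuousOn)
  have hUd : ∀ s ∈ Ico τ t, HasDerivWithinAt U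
      (fderiv ℝ V (x s) (f (x s) + outAfter z τ δ u₀ j x k s • g (x s)) +
        2 / Ω * (2 * τ * y s - ∫ m in (s - 2 * τ)..s, y m)) (Ici s) s := fun s hs =>
    (h.hasDerivWithinAt_comp hA.V_contDiff (hτ.le.trans hs.1) (hT s hs.2.le)).add
      ((hasDerivAt_delayMemory hyc s).hasDerivWithinAt.const_mul _)
  have hUdec : ∀ s ∈ Ico τ t, c ≤ U s →
      fderiv ℝ V (x s) (f (x s) + outAfter z τ δ u₀ j x k s • g (x s)) +
        2 / Ω * (2 * τ * y s - ∫ m in (s - 2 * τ)..s, y m) ≤ -ν := by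
    intro s hs hcs
    have hs0 : 0 ≤ s := hτ.le.trans hs.1
    have hsT := hT s hs.2.le
    have h1 := hA.decrease_along hA2 hf hg hτ hδ hu hφ h hmode hs.1 hsT
      (hBv _ (hM s hs0 hsT)) (fun m hm => hBz _ (hM m (by linarith [hm.1, hs.1])
        (hT m (hm.2.trans hs.2.le))))
    have hss : s ∈ Icc τ t := ⟨hs.1, hs.2.le⟩
    rw [← hyint s hss, ← hye s ⟨by linarith, hs.2.le⟩] at h1
    set I := ∫ m in (s - 2 * τ)..s, y m with hI
    have hI0 : 0 ≤ I := intervalIntegral.integral_nonneg (by linarith) fun m _ => hW0 _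
    have hys0 : 0 ≤ y s := hW0 _
    have h2 : 2 / Ω * (2 * τ * y s) ≤ 1 / 4 * y s := by
      have : 2 / Ω * (2 * τ) ≤ 1 / 4 := by
        rw [div_mul_eq_mul_div, div_le_iff₀ hΩ0]; linarith
      calc 2 / Ω * (2 * τ * y s) = 2 / Ω * (2 * τ) * y s := by ring
        _ ≤ _ := mul_le_mul_of_nonneg_right this hys0
    -- One summand of `U ≥ c` is at least `c/2`: either `V`, and `W ≥ 4ν`, or the memory, and then
    -- `(1/Ω) I ≥ c/(8τ)`.
    have h3 : 2 * ν ≤ 1 / 2 * y s + 1 / Ω * I := by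
      rcases le_or_gt (c / 2) (V (x s)) with hVc | hVc
      · have := hνW _ (hM s hs0 hsT) hVc
        rw [← hye s ⟨by linarith, hs.2.le⟩] at this
        have h4 : 0 ≤ 1 / Ω * I := by positivity
        linarith
      · have h4 : c / 2 ≤ 2 / Ω * (2 * τ * I) := by
          have := mul_le_mul_of_nonneg_left (hmem s).2 (by positivity : 0 ≤ 2 / Ω)
          simp only [hU] at hcs
          linarith
        have h5 : c / (8 * τ) ≤ 1 / Ω * I := by
          rw [div_le_iff₀ (by positivity)]
          have : 2 / Ω * (2 * τ * I) = 1 / Ω * I * (4 * τ) := by ring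
          rw [this] at h4
          linarith
        linarith
    have h4 : 2 / Ω * (2 * τ * y s - I) = 2 / Ω * (2 * τ * y s) - 2 * (1 / Ω * I) := by ring
    rw [h4]
    linarith
  have hUτ : U τ ≤ E' := by
    have hbd : ∀ s ∈ Icc (τ - 2 * τ) τ, y s ≤ w := fun s hs => by
      rw [hye s ⟨by linarith [hs.1], hs.2.trans htτ⟩]
      refine hw _ ?_
      rcases le_total s 0 with h1 | h1
      · have : s ∈ Icc (-(2 * τ)) 0 := ⟨by linarith [hs.1], h1⟩
        rw [h.history s this]
        exact (hφR s this).trans hRr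
      · have := hA.bound_first_delay hA3 hτ hδ hu hφR h hmode h1 hs.2 (hT s (hs.2.trans htτ))
        exact hr _ (by linarith)
    have h1 : ∫ m in (τ - 2 * τ)..τ, y m ≤ 2 * τ * w := by
      have := intervalIntegral.integral_mono_on (μ := MeasureTheory.volume)
        (by linarith : τ - 2 * τ ≤ τ)
        (hyc.intervalIntegrable _ _) intervalIntegrable_const hbd
      rw [intervalIntegral.integral_const, smul_eq_mul] at this
      linarith
    have h2 := hA.bound_first_delay hA3 hτ hδ hu hφR h hmode hτ.le le_rfl (hT τ htτ)
    have h3 : 2 / Ω * delayMemory τ y τ ≤ 2 / Ω * (2 * τ * (2 * τ * w)) :=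
      mul_le_mul_of_nonneg_left ((hmem τ).2.trans
        (mul_le_mul_of_nonneg_left h1 (by positivity))) (by positivity)
    simp only [hU]
    linarith
  have hfin := le_or_le_sub_of_deriv_right hν hUc hUd hUdec (t := t) ⟨htτ, le_rfl⟩
  have htτ0 : 0 ≤ ν * (t - τ) := mul_nonneg hν.le (by linarith)
  refine ⟨?_, fun hlate => ?_⟩
  · rcases hfin with h1 | h1 <;> linarith [hVU t]
  · rcases hfin with h1 | h1
    · exact (hVU t).trans h1
    · have h2 : E' / ν ≤ t - τ := by linarith
      rw [div_le_iff₀ hν] at h2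
      linarith [hVU t]

/-- Practical stabilization for a fixed radius, with a saturation level independent of the target
accuracy and a resolution of the quantizer depending on both. -/
theorem RobustCLF.exists_quantizer (hA : RobustCLF f g δ V W z κ₁ κ₂)
    (hA2 : DelayRobust f g τ δ Ω V W z) (hA3 : GrowthRobust g V W z κ₃)
    (hf : LocallyLipschitz f) (hg : LocallyLipschitz g) (hΩ : 16 * τ ≤ Ω)
    (hτ : 0 < τ) (hδ : δ ∈ Ioo (0 : ℝ) 1) {R : ℝ} (hR : 0 ≤ R) :
    ∃ U > 0, ∀ ε > 0, ∃ η > 0, ∀ (u₀ : ℝ) (j : ℕ), U ≤ u₀ → mainLevel δ u₀ j ≤ η →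
      ∀ φ : ℝ → EuclideanSpace ℝ (Fin n), ContDiffOn ℝ 1 φ (Icc (-(2 * τ)) 0) →
        (∀ t ∈ Icc (-(2 * τ)) 0, ‖φ t‖ ≤ R) → SolutionEntersBall f g z τ δ u₀ j φ ε := by
  have hΩ0 : 0 < Ω := by linarith
  have h1δ : 0 < 1 - δ := by linarith [hδ.2]
  have hsub : ∀ E : ℝ, ∃ r, ∀ p, V p ≤ E → ‖p‖ < r := fun E => by
    obtain ⟨r, hr⟩ := (hA.κ₁_classK.tendsto.eventually_gt_atTop E).exists_forall_of_atTop
    refine ⟨r, fun p hp => ?_⟩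
    by_contra! hc
    linarith [hr _ hc, hA.lower p]
  have hbdd : ∀ (F : EuclideanSpace ℝ (Fin n) → ℝ) (r : ℝ), Continuous F →
      ∃ B, ∀ p, ‖p‖ ≤ r → |F p| ≤ B := fun F r hF => by
    obtain ⟨B, hB⟩ := (isCompact_closedBall (0 : EuclideanSpace ℝ (Fin n)) r).exists_bound_of_continuousOn
      hF.continuousOn
    exact ⟨B, fun p hp => hB p (by simpa using hp)⟩
  set E := (κ₂ R + 1) * Real.exp (κ₃ R * τ) with hE
  obtain ⟨r₁, hr₁⟩ := hsub E
  set r := max r₁ R with hr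
  obtain ⟨w, hw⟩ := hbdd W r hA.W_continuous
  -- The `1` guarantees `c ≤ E'` later, although `E'` is fixed before `ε`.
  set E' := max 1 (E + 2 / Ω * (2 * τ * (2 * τ * w))) with hE'
  obtain ⟨r₂, hr₂⟩ := hsub E'
  -- Initial functions and the set `{V ≤ E'}` both lie strictly inside the ball of radius `M`.
  set M := max r₂ (R + 1) with hM
  have hRM : R < M := lt_of_lt_of_le (by linarith) (le_max_right r₂ (R + 1))
  have hM0 : 0 < M := hR.trans_lt hRM
  obtain ⟨Bu, hBu⟩ := hbdd z M hA.z_contDiff.continuous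
  obtain ⟨Bv, hBv⟩ := hbdd (lieDer g V) M (continuous_lieDer hg.continuous hA.V_contDiff)
  obtain ⟨Bz, hBz⟩ := hbdd (lieDer g z) M (continuous_lieDer hg.continuous hA.z_contDiff)
  obtain ⟨K₁, hK₁⟩ := hf.exists_lipschitzWith_comp_radialRetraction hM0
  obtain ⟨K₂, hK₂⟩ := hg.exists_lipschitzWith_comp_radialRetraction hM0
  obtain ⟨K₃, hK₃⟩ :=
    hA.z_contDiff.locallyLipschitz.exists_lipschitzWith_comp_radialRetraction hM0
  set K := max K₁ (max K₂ K₃) with hK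
  obtain ⟨B₁, hB₁⟩ := hbdd (fun p => ‖f p‖) M hf.continuous.norm
  obtain ⟨B₂, hB₂⟩ := hbdd (fun p => ‖g p‖) M hg.continuous.norm
  simp only [abs_norm] at hB₁ hB₂
  have hBv0 : 0 ≤ Bv := (abs_nonneg _).trans (hBv 0 (by simpa using hM0.le))
  have hBz0 : 0 ≤ Bz := (abs_nonneg _).trans (hBz 0 (by simpa using hM0.le))
  -- At this level the truncated feedback stays in the range of the quantizer. No constant chosen so
  -- far depends on `ε`, `u₀` or `j`.
  refine ⟨max 1 (Bu * (1 - δ)), by positivity, fun ε hε => ?_⟩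
  set c := min (κ₁ ε) 1 with hc
  have hκε : 0 < κ₁ ε := by
    have := hA.κ₁_classK.strictMonoOn (le_refl (0 : ℝ)) hε.le hε
    rwa [hA.κ₁_classK.zero] at this
  have hc0 : 0 < c := lt_min hκε one_pos
  -- `V(0) = 0 < c/2` keeps the origin out of this compact set, so `W` is bounded below there.
  obtain ⟨μ, hμ0, hμ⟩ : ∃ μ, 0 < μ ∧ ∀ p, ‖p‖ ≤ M → c / 2 ≤ V p → μ ≤ W p := by
    have hcomp : IsCompact (Metric.closedBall (0 : EuclideanSpace ℝ (Fin n)) M ∩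
        {p | c / 2 ≤ V p}) := (isCompact_closedBall _ _).inter_right
      (isClosed_le continuous_const hA.V_contDiff.continuous)
    obtain ⟨μ, hμ0, hμ⟩ := hcomp.exists_forall_le' hA.W_continuous.continuousOn (a := 0)
      fun p hp => hA.W_posDef.2 p (by
        rintro rfl
        have := hp.2
        simp only [mem_ofPred_eq, hA.V_posDef.1] at this
        linarith)
    exact ⟨μ, hμ0, fun p hp hpc => hμ p ⟨by simpa using hp, hpc⟩⟩
  set ν := min (μ / 4) (c / (8 * τ) / 2) with hν
  have hν0 : 0 < ν := lt_min (by positivity) (by positivity)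
  have hC0 : 0 ≤ Bv * (1 + 2 * τ * Bz) := by positivity
  refine ⟨ν / (Bv * (1 + 2 * τ * Bz) + 1), by positivity, fun u₀ j hu₀ hres φ hφ hφR => ?_⟩
  have hu : 0 < u₀ := lt_of_lt_of_le one_pos ((le_max_left _ _).trans hu₀)
  have hres' : Bv * (1 + 2 * τ * Bz) * mainLevel δ u₀ j ≤ ν := by
    rw [le_div_iff₀ (by positivity)] at hres
    have := mainLevel_pos hδ hu j
    linarith
  obtain ⟨L, hL⟩ := exists_lipschitz_bound_of_contDiffOn (by linarith) hφ
  obtain ⟨x, k, hx, hmode⟩ := exists_global_hystereticSolution (j := j) (φ := φ) (K := K)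
    (B := max B₁ B₂) (L := L)
    (hK₁.weaken (le_max_left _ _)) (hK₂.weaken ((le_max_left _ _).trans (le_max_right _ _)))
    (hK₃.weaken ((le_max_right _ _).trans (le_max_right _ _)))
    (fun p => (hB₁ _ (norm_radialRetraction_le hM0 p)).trans (le_max_left _ _))
    (fun p => (hB₂ _ (norm_radialRetraction_le hM0 p)).trans (le_max_right _ _))
    (fun p => (hBu _ (norm_radialRetraction_le hM0 p)).trans (by
      rw [le_div_iff₀ h1δ]; exact (le_max_right _ _).trans hu₀)) hτ hδ hu hL
  -- The horizon is arbitrary so that the estimate applies first up to a hypothetical exit time from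
  -- the ball and then for all times.
  have hest : ∀ T : EReal, 0 < T → (∀ t : ℝ, -(2 * τ) ≤ t → (t : EReal) < T → ‖x t‖ ≤ M) →
      ∀ t : ℝ, 0 ≤ t → (t : EReal) < T → V (x t) ≤ E' ∧ (τ + E' / ν ≤ t → V (x t) ≤ c) := by
    intro T hT0 hTM t h0 ht
    refine hA.lyapunov_estimate hA2 hA3 hf.continuous hg.continuous hΩ hτ hδ hu hφ hφR
      (hx.of_radialRetraction hM0 hτ hT0 hTM) (fun s hs0 hsT => ?_) le_rfl
      (fun p hp => (hr₁ p hp).le.trans (le_max_left _ _)) (le_max_right _ _)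
      (fun p hp => (le_abs_self _).trans (hw p hp)) (le_max_right _ _)
      (fun s hs0 hsT => hTM s (by linarith) hsT) hBv hBz hc0
      ((min_le_right _ _).trans (le_max_left _ _)) hν0
      (fun p hp hpc => le_trans (by linarith [min_le_left (μ / 4) (c / (8 * τ) / 2)]) (hμ p hp hpc))
      (by linarith [min_le_right (μ / 4) (c / (8 * τ) / 2)]) hres' h0 ht
    have := hmode s hs0
    rwa [Function.comp, radialRetraction_of_norm_le hM0 (hTM (s - τ) (by linarith)
      ((EReal.coe_lt_coe_iff.2 (by linarith)).trans hsT))] at this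
  have hneg : ∀ t : ℝ, -(2 * τ) ≤ t → t ≤ 0 → ‖x t‖ < M := fun t h1 h2 => by
    rw [hx.history t ⟨h1, h2⟩]; exact (hφR t ⟨h1, h2⟩).trans_lt hRM
  have hxc : ContinuousOn x (Ici 0) := hx.continuousOn.mono fun t ht =>
    ⟨by have : 0 ≤ t := ht; linarith, EReal.coe_lt_top t⟩
  -- At the first time on the sphere, continuity still gives `V ≤ E'`, which forces the norm below
  -- `M`.
  have hball : ∀ t : ℝ, -(2 * τ) ≤ t → ‖x t‖ ≤ M := by
    by_contra! hcon
    obtain ⟨b, hb, hbM⟩ := hcon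
    have hb0 : 0 ≤ b := by
      by_contra! hlt
      exact absurd (hneg b hb hlt.le) (not_lt.2 hbM.le)
    set S : Set ℝ := {t | t ∈ Icc 0 b ∧ M ≤ ‖x t‖} with hS
    have hSc : IsCompact S := isCompact_Icc.of_isClosed_subset
      ((hxc.mono Icc_subset_Ici_self).norm.preimage_isClosed_of_isClosed isClosed_Icc isClosed_Ici)
      fun t ht => ht.1
    obtain ⟨t₁, ht₁, hleast⟩ := hSc.exists_isLeast ⟨b, ⟨hb0, le_rfl⟩, hbM.le⟩
    have ht₁0 : 0 < t₁ := by
      refine lt_of_le_of_ne ht₁.1.1 ?_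
      rintro rfl
      exact absurd (hneg 0 (by linarith) le_rfl) (not_lt.2 ht₁.2)
    have hlt : ∀ t : ℝ, -(2 * τ) ≤ t → t < t₁ → ‖x t‖ < M := fun t h1 h2 => by
      rcases le_total t 0 with h3 | h3
      · exact hneg t h1 h3
      · by_contra! h4
        exact absurd (hleast ⟨⟨h3, h2.le.trans ht₁.1.2⟩, h4⟩) (not_le.2 h2)
    have hV := hest t₁ (by exact_mod_cast ht₁0)
      (fun t h1 h2 => (hlt t h1 (EReal.coe_lt_coe_iff.1 h2)).le)
    have hVt₁ : V (x t₁) ≤ E' := by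
      have hlim : Tendsto (fun t => V (x t)) (𝓝[<] t₁) (𝓝 (V (x t₁))) := by
        refine ((hA.V_contDiff.continuous.comp_continuousOn hxc) t₁ ht₁0.le).mono_left
          (nhdsWithin_le_of_mem ?_)
        filter_upwards [Ioo_mem_nhdsLT ht₁0] with s hs using hs.1.le
      refine le_of_tendsto hlim ?_
      filter_upwards [Ioo_mem_nhdsLT ht₁0] with s hs
      exact (hV s hs.1.le (EReal.coe_lt_coe_iff.2 hs.2)).1
    exact absurd ((hr₂ _ hVt₁).trans_le (le_max_left _ _)) (not_lt.2 ht₁.2)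
  have hsol : IsHystereticSolution f g z τ δ u₀ j φ ⊤ x k :=
    hx.of_radialRetraction hM0 hτ EReal.zero_lt_top fun t h1 _ => hball t h1
  have hE'0 : 0 < E' := lt_of_lt_of_le one_pos (le_max_left _ _)
  refine ⟨x, k, hsol, fun T x' k' hT hx' t ht => ⟨fun h1 => ?_, fun h1 => ?_⟩,
    τ + E' / ν, by positivity, fun t ht => ?_⟩
  · rcases le_total t 0 with h2 | h2
    · rw [hx'.history t ⟨h1, h2⟩, hsol.history t ⟨h1, h2⟩]
    · exact (hx'.eq_of_lt hf hg hτ hδ hu hsol h2 ht (EReal.coe_lt_top t)).1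
  · exact (hx'.eq_of_lt hf hg hτ hδ hu hsol h1 ht (EReal.coe_lt_top t)).2
  · have ht0 : 0 ≤ t := le_trans (by positivity) ht
    have h1 := (hest ⊤ EReal.zero_lt_top (fun t h1 _ => hball t h1) t ht0
      (EReal.coe_lt_top t)).2 ht
    by_contra! hlt
    have h2 := hA.κ₁_classK.strictMonoOn hε.le (norm_nonneg (x t)) hlt
    linarith [hA.lower (x t), min_le_left (κ₁ ε) 1]

end

/-! ### Continuous bounds from integer samples, and conclusion. -/

/-- A sequence has a positive, continuous and nondecreasing majorant on `[0, ∞)`. -/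
lemma exists_continuous_monotone_majorant (a : ℕ → ℝ) :
    ∃ G : ℝ → ℝ, Continuous G ∧ Monotone G ∧ (∀ s, 0 ≤ s → 0 < G s) ∧
      ∀ s, 0 ≤ s → a ⌈s⌉₊ ≤ G s := by
  set A : ℕ → ℝ := fun N => 1 + ∑ i ∈ Finset.range (N + 1), |a i| with hA
  have hAm : Monotone A := fun N N' h => by
    simp only [hA]
    gcongr
  have hA1 : ∀ N, 1 ≤ A N := fun N =>
    le_add_of_nonneg_right (Finset.sum_nonneg fun i _ => abs_nonneg _)
  have haA : ∀ N, a N ≤ A N := fun N => by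
    have := Finset.single_le_sum (f := fun i => |a i|) (fun i _ => abs_nonneg _)
      (Finset.self_mem_range_succ N)
    linarith [le_abs_self (a N)]
  -- Integrating this step function over `[0, s + 1]` makes it continuous; the last unit interval
  -- alone contributes at least `A ⌈s⌉₊`.
  set F : ℝ → ℝ := fun t => A ⌈t⌉₊ with hF
  have hFm : Monotone F := hAm.comp Nat.ceil_mono
  have hFi : ∀ b c, IntervalIntegrable F MeasureTheory.volume b c := fun b c =>
    (hFm.monotoneOn _).intervalIntegrable
  have hF0 : ∀ t, 0 ≤ F t := fun t => zero_le_one.trans (hA1 _)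
  have hmono : Monotone fun s : ℝ => ∫ t in (0 : ℝ)..(s + 1), F t := fun s s' h => by
    simp only
    rw [← sub_nonneg, intervalIntegral.integral_interval_sub_left (hFi _ _) (hFi _ _)]
    exact intervalIntegral.integral_nonneg (by linarith) fun t _ => hF0 t
  have hge : ∀ s, 0 ≤ s → A ⌈s⌉₊ ≤ ∫ t in (0 : ℝ)..(s + 1), F t := fun s hs => by
    rw [← intervalIntegral.integral_add_adjacent_intervals (hFi 0 s) (hFi s (s + 1))]
    have h1 : 0 ≤ ∫ t in (0 : ℝ)..s, F t :=
      intervalIntegral.integral_nonneg hs fun t _ => hF0 t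
    have h2 : ∫ _ in s..(s + 1), A ⌈s⌉₊ ≤ ∫ t in s..(s + 1), F t :=
      intervalIntegral.integral_mono_on (by linarith) intervalIntegrable_const (hFi _ _)
        fun t ht => hFm ht.1
    rw [intervalIntegral.integral_const, smul_eq_mul, add_sub_cancel_left, one_mul] at h2
    linarith
  exact ⟨_, (intervalIntegral.continuous_primitive hFi 0).comp (by fun_prop), hmono,
    fun s hs => (zero_lt_one.trans_le (hA1 _)).trans_le (hge s hs),
    fun s hs => (haA _).trans (hge s hs)⟩

lemma SolutionEntersBall.mono {n : ℕ}
    {f g : EuclideanSpace ℝ (Fin n) → EuclideanSpace ℝ (Fin n)}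
    {z : EuclideanSpace ℝ (Fin n) → ℝ} {τ δ u₀ : ℝ} {j : ℕ}
    {φ : ℝ → EuclideanSpace ℝ (Fin n)} {ε ε' : ℝ} (hε : ε ≤ ε')
    (h : SolutionEntersBall f g z τ δ u₀ j φ ε) : SolutionEntersBall f g z τ δ u₀ j φ ε' := by
  obtain ⟨x, k, h1, h2, tₛ, h3, h4⟩ := h
  exact ⟨x, k, h1, h2, tₛ, h3, fun t ht => (h4 t ht).trans hε⟩

/-- The number of levels that makes the finest level at most `η`. -/
lemma mainLevel_le_of_log_le {δ u₀ u η J : ℝ} {j : ℕ} (hδ : δ ∈ Ioo (0 : ℝ) 1) (hu : 0 < u)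
    (hu₀ : 0 < u₀) (hη : 0 < η) (hJ : Real.log (u / η) / Real.log ((1 + δ) / (1 - δ)) ≤ J)
    (hj : J + Real.log (u₀ / u) / Real.log ((1 + δ) / (1 - δ)) ≤ j) : mainLevel δ u₀ j ≤ η := by
  have h1 : 0 < 1 - δ := by linarith [hδ.2]
  have h2 : 0 < 1 + δ := by linarith [hδ.1]
  have hq : 0 < Real.log ((1 + δ) / (1 - δ)) :=
    Real.log_pos ((one_lt_div h1).2 (by linarith [hδ.1]))
  have hm := mainLevel_pos hδ hu₀ j
  rw [← Real.log_le_log_iff hm hη, mainLevel, Real.log_mul (by positivity) hu₀.ne', Real.log_pow,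
    ← inv_div, Real.log_inv]
  -- As `log ρ = -log((1+δ)/(1-δ))`, it suffices that `j log((1+δ)/(1-δ))` be at least `log(u/η) +
  -- log(u₀/u) = log(u₀/η)`.
  have h3 := (add_le_add_left hJ _).trans hj
  rw [← add_div, div_le_iff₀ hq, Real.log_div hu.ne' hη.ne', Real.log_div hu₀.ne' hu.ne'] at h3
  linarith

theorem proposition1 {n : ℕ}
    (f g : EuclideanSpace ℝ (Fin n) → EuclideanSpace ℝ (Fin n))
    (hf : LocallyLipschitz f) (hg : LocallyLipschitz g)
    (τ δ : ℝ) (hτ : 0 < τ) (hδ : δ ∈ Set.Ioo (0 : ℝ) 1)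
    (V W z : EuclideanSpace ℝ (Fin n) → ℝ) (κ₁ κ₂ : ℝ → ℝ)
    (hA1 : RobustCLF f g δ V W z κ₁ κ₂)
    (Ω : ℝ) (hΩ : 16 * τ ≤ Ω) (hA2 : DelayRobust f g τ δ Ω V W z)
    (κ₃ : ℝ → ℝ) (hA3 : GrowthRobust g V W z κ₃) :
    SemiGloballyPracticallyStabilizable f g τ δ ∧
    ∃ (uMin : ℝ → ℝ) (jMin : ℝ → ℝ → ℝ),
      ContinuousOn uMin (Set.Ici 0) ∧ MonotoneOn uMin (Set.Ici 0) ∧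
      (∀ R : ℝ, 0 ≤ R → 0 < uMin R) ∧
      ContinuousOn (fun q : ℝ × ℝ => jMin q.1 q.2) (Set.Ioi 0 ×ˢ Set.Ici 0) ∧
      (∀ ε R : ℝ, 0 < ε → 0 ≤ R → 0 < jMin ε R) ∧
      ∀ ε R : ℝ, 0 < ε → ε < R →
        ∀ (u₀ : ℝ) (j : ℕ), uMin R ≤ u₀ →
          jMin ε R + Real.log (u₀ / uMin R) / Real.log ((1 + δ) / (1 - δ)) ≤ (j : ℝ) →
          ∀ φ : ℝ → EuclideanSpace ℝ (Fin n),
            ContDiffOn ℝ 1 φ (Set.Icc (-(2 * τ)) 0) →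
            (∀ t ∈ Set.Icc (-(2 * τ)) 0, ‖φ t‖ ≤ R) →
            SolutionEntersBall f g z τ δ u₀ j φ ε := by
  suffices H : ∃ (uMin : ℝ → ℝ) (jMin : ℝ → ℝ → ℝ),
      ContinuousOn uMin (Set.Ici 0) ∧ MonotoneOn uMin (Set.Ici 0) ∧
      (∀ R : ℝ, 0 ≤ R → 0 < uMin R) ∧
      ContinuousOn (fun q : ℝ × ℝ => jMin q.1 q.2) (Set.Ioi 0 ×ˢ Set.Ici 0) ∧
      (∀ ε R : ℝ, 0 < ε → 0 ≤ R → 0 < jMin ε R) ∧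
      ∀ ε R : ℝ, 0 < ε → ε < R →
        ∀ (u₀ : ℝ) (j : ℕ), uMin R ≤ u₀ →
          jMin ε R + Real.log (u₀ / uMin R) / Real.log ((1 + δ) / (1 - δ)) ≤ (j : ℝ) →
          ∀ φ : ℝ → EuclideanSpace ℝ (Fin n),
            ContDiffOn ℝ 1 φ (Set.Icc (-(2 * τ)) 0) →
            (∀ t ∈ Set.Icc (-(2 * τ)) 0, ‖φ t‖ ≤ R) →
            SolutionEntersBall f g z τ δ u₀ j φ ε by
    refine ⟨fun ε R hε hR => ?_, H⟩
    obtain ⟨uMin, jMin, -, -, hu, -, hj, hmain⟩ := H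
    have hR0 : 0 ≤ R := hε.le.trans hR.le
    refine ⟨z, uMin R, ⌈jMin ε R⌉₊, hA1.z_contDiff, hu R hR0, Nat.ceil_pos.2 (hj ε R hε hR0),
      hmain ε R hε hR (uMin R) _ le_rfl ?_⟩
    rw [div_self (hu R hR0).ne', Real.log_one, zero_div, add_zero]
    exact Nat.le_ceil _
  -- Radii are sampled at integers and accuracies at `1/(m+1)`. `U` is chosen before the accuracy,
  -- so `uMin` depends on `R` alone.
  choose U hU0 hU using fun N : ℕ =>
    hA1.exists_quantizer hA2 hA3 hf hg hΩ hτ hδ (R := N) N.cast_nonneg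
  choose η hη0 hη using fun N m : ℕ => hU N (1 / ((m : ℝ) + 1)) (by positivity)
  obtain ⟨uMin, huc, hum, hu0, huU⟩ := exists_continuous_monotone_majorant U
  set lq := Real.log ((1 + δ) / (1 - δ)) with hlq
  have hq : 0 < lq := Real.log_pos ((one_lt_div (by linarith [hδ.2])).2 (by linarith [hδ.1]))
  -- One variable suffices: `⌈R + 1/ε⌉₊` dominates `⌈R⌉₊` and `⌈1/ε⌉₊`, so the double sum contains
  -- the term needed. It uses `uMin K ≥ uMin R`, a value determined by `K` alone.
  obtain ⟨G, hGc, -, hG0, hGJ⟩ := exists_continuous_monotone_majorant fun K =>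
    ∑ i ∈ Finset.range (K + 1), ∑ m ∈ Finset.range (K + 1), |Real.log (uMin K / η i m) / lq|
  refine ⟨uMin, fun ε R => G (R + 1 / ε), huc.continuousOn, hum.monotoneOn _, hu0, ?_,
    fun ε R hε hR => hG0 _ (by positivity), ?_⟩
  · refine hGc.comp_continuousOn (continuousOn_snd.add
      (continuousOn_const.div continuousOn_fst fun q hq => ?_))
    exact (Set.mem_Ioi.1 hq.1).ne'
  · intro ε R hε hεR u₀ j hu₀ hj φ hφ hφR
    have hR0 : 0 ≤ R := hε.le.trans hεR.le
    have hε' : 0 ≤ 1 / ε := by positivity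
    set i := ⌈R⌉₊ with hi
    set m := ⌈1 / ε⌉₊ with hm
    set K := ⌈R + 1 / ε⌉₊ with hK
    have hiK : i ≤ K := Nat.ceil_mono (by linarith)
    have hmK : m ≤ K := Nat.ceil_mono (by linarith)
    have hRK : R ≤ K := (by linarith : R ≤ R + 1 / ε).trans (Nat.le_ceil _)
    have hJ : Real.log (uMin R / η i m) / lq ≤ G (R + 1 / ε) := by
      have h1 : Real.log (uMin R / η i m) / lq ≤ |Real.log (uMin K / η i m) / lq| := by
        refine le_trans ?_ (le_abs_self _)
        have := hη0 i m
        have := hu0 R hR0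
        have := hum hRK
        gcongr
      have h2 := Finset.single_le_sum (f := fun m => |Real.log (uMin K / η i m) / lq|)
        (fun _ _ => abs_nonneg _) (Finset.mem_range.2 (by omega : m < K + 1))
      have h3 := Finset.single_le_sum (f := fun i => ∑ m ∈ Finset.range (K + 1),
        |Real.log (uMin K / η i m) / lq|) (fun _ _ => Finset.sum_nonneg fun _ _ => abs_nonneg _)
        (Finset.mem_range.2 (by omega : i < K + 1))
      exact h1.trans (h2.trans (h3.trans (hGJ _ (by positivity))))
    have hres := mainLevel_le_of_log_le hδ (hu0 R hR0) ((hu0 R hR0).trans_le hu₀) (hη0 i m) hJ hj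
    refine (hη i m u₀ j ((huU R hR0).trans hu₀) hres φ hφ
      fun t ht => (hφR t ht).trans (Nat.le_ceil R)).mono ?_
    rw [div_le_iff₀ (by positivity)]
    have := Nat.le_ceil (1 / ε)
    rw [div_le_iff₀ hε] at this
    linarith
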